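/- Let $X$ be a complex Hilbert space, $Y$ a complex Banach space, and let $-A$ be the generator of a strongly continuous semigroup $(T(t))_{t\ge 0}$ on $X$. Suppose that there is a constant $\omega>0$ such that $A+\omega$ is accretive, i.e. $\operatorname{Re}\langle (A+\omega)x,x\rangle\ge 0$ for all $x\in D(A)$, and let $C:D(A)\to Y$ be linear and bounded for the graph norm $\|x\|+\|Ax\|$ of $D(A)$. Suppose that there is $\delta>0$ such that for every $x\in D(A)$ the vector $(A+\omega)^{-1/2}x$ is defined and belongs to $D(A)$, and $$\|C(A+\omega)^{-1/2}x\|_Y\ \ge\ \delta\,\|x\| .$$ Here $(A+\omega)^{-1/2}x=\frac1\pi\int_0^\infty s^{-1/2}(s+A+\omega)^{-1}x\,ds$, where $x$ is in the domain of $(A+\omega)^{-1/2}$ when this integral (improper at $0$) converges in $X$. Then $C$ is exactly observable in finite time: there are $\eta>0$ and $m>0$ such that $$\int_0^\eta \|C\,T(t)x\|_Y^2\,dt\ \ge\ m^2\qquad\text{for all } x\in D(A)\text{ with }\|x\|=1 .$$ -/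

import Mathlib

open Filter Topology MeasureTheory
open scoped NNReal

/-- A strongly continuous semigroup of bounded linear operators on `X`. -/
structure C0Semigroup (X : Type*) [NormedAddCommGroup X] [NormedSpace ℂ X] where
  op : ℝ≥0 → X →L[ℂ] X
  op_zero : op 0 = ContinuousLinearMap.id ℂ X
  op_add : ∀ s t : ℝ≥0, op (s + t) = (op s).comp (op t)
  strongly_continuous : ∀ x : X, Continuous fun t : ℝ≥0 => op t x

namespace C0Semigroup

variable {X : Type*} [NormedAddCommGroup X] [NormedSpace ℂ X]

/-- The difference quotient `(T(t)x - x) / t`. -/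
noncomputable def diffQuot (T : C0Semigroup X) (x : X) (t : ℝ≥0) : X :=
  (((t : ℝ)⁻¹ : ℝ) : ℂ) • (T.op t x - x)

theorem diffQuot_add (T : C0Semigroup X) (x y : X) (t : ℝ≥0) :
    T.diffQuot (x + y) t = T.diffQuot x t + T.diffQuot y t := by
  simp only [diffQuot, map_add, ← smul_add]
  congr 1
  abel

theorem diffQuot_smul (T : C0Semigroup X) (c : ℂ) (x : X) (t : ℝ≥0) :
    T.diffQuot (c • x) t = c • T.diffQuot x t := by
  simp only [diffQuot, map_smul, ← smul_sub]
  rw [smul_comm]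

/-- The infinitesimal generator of `T`: its domain is the set of all `x` for which
`lim_{t → 0+} (T(t)x - x) / t` exists, and its value at `x` is that limit. -/
noncomputable def generator (T : C0Semigroup X) : X →ₗ.[ℂ] X where
  domain :=
    { carrier := {x | ∃ y, Tendsto (T.diffQuot x) (𝓝[>] 0) (𝓝 y)}
      add_mem' := by
        rintro a b ⟨y, hy⟩ ⟨z, hz⟩
        exact ⟨y + z, (hy.add hz).congr fun t => (T.diffQuot_add a b t).symm⟩
      zero_mem' := ⟨0, tendsto_const_nhds.congr fun t => by simp [diffQuot]⟩
      smul_mem' := by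
        rintro c a ⟨y, hy⟩
        exact ⟨c • y, (hy.const_smul c).congr fun t => (T.diffQuot_smul c a t).symm⟩ }
  toFun :=
    { toFun := fun x => x.2.choose
      map_add' := fun a b => tendsto_nhds_unique (a + b).2.choose_spec
        ((a.2.choose_spec.add b.2.choose_spec).congr fun t => (T.diffQuot_add a b t).symm)
      map_smul' := fun c a => tendsto_nhds_unique (c • a).2.choose_spec
        ((a.2.choose_spec.const_smul c).congr fun t => (T.diffQuot_smul c a t).symm) }

theorem op_mem_generator_domain (T : C0Semigroup X) (s : ℝ≥0) {x : X}
    (hx : x ∈ T.generator.domain) : T.op s x ∈ T.generator.domain := by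
  obtain ⟨y, hy⟩ := hx
  refine ⟨T.op s y, (((T.op s).continuous.tendsto y).comp hy).congr fun t => ?_⟩
  have h : T.op t (T.op s x) = T.op s (T.op t x) := by
    rw [← ContinuousLinearMap.comp_apply, ← T.op_add, add_comm, T.op_add,
      ContinuousLinearMap.comp_apply]
  simp [diffQuot, h]

/-- If `-A` is the generator of `T`, then `T(s)` maps `D(A)` into `D(A)`; this is `T(s)` as a
map of `D(A)`. -/
def onDomain (T : C0Semigroup X) {A : X →ₗ.[ℂ] X} (hA : T.generator = -A) (s : ℝ≥0)
    (x : A.domain) : A.domain :=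
  ⟨T.op s x, by
    have h : T.generator.domain = A.domain := by rw [hA, LinearPMap.neg_domain]
    exact h.le (T.op_mem_generator_domain s (h.ge x.2))⟩

/-- `C` is exactly `L²`-observable in time `η`: the infimum of `∫₀^η ‖C T(t) x‖² dt` over the
unit vectors `x` of `D(A)` is positive. -/
def ExactlyObservableInTime {Y : Type*} [NormedAddCommGroup Y] [NormedSpace ℂ Y]
    (T : C0Semigroup X) {A : X →ₗ.[ℂ] X} (hA : T.generator = -A) (C : A.domain →ₗ[ℂ] Y)
    (η : ℝ) : Prop :=
  ∃ m : ℝ, 0 < m ∧ ∀ x : A.domain, ‖(x : X)‖ = 1 →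
    m ^ 2 ≤ ∫ t in (0 : ℝ)..η, ‖C (T.onDomain hA t.toNNReal x)‖ ^ 2

end C0Semigroup

namespace LinearPMap

/-- The operator `B + c` with domain `D(B)`. -/
def addScalar {X : Type*} [NormedAddCommGroup X] [NormedSpace ℂ X]
    (B : X →ₗ.[ℂ] X) (c : ℝ) : X →ₗ.[ℂ] X :=
  ((c : ℂ) • (LinearMap.id : X →ₗ[ℂ] X)) +ᵥ B

/-- `B` is accretive: `Re ⟨B x, x⟩ ≥ 0` on `D(B)`. -/
def IsAccretive {X : Type*} [NormedAddCommGroup X] [InnerProductSpace ℂ X]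
    (B : X →ₗ.[ℂ] X) : Prop :=
  ∀ x : B.domain, 0 ≤ (inner ℂ (B x) (x : X)).re

/-- Boundedness of an operator on `D(B)` for the graph norm `‖x‖ + ‖B x‖`. -/
def IsBoundedOnDomain {X Y : Type*} [NormedAddCommGroup X] [NormedSpace ℂ X]
    [NormedAddCommGroup Y] [NormedSpace ℂ Y]
    (B : X →ₗ.[ℂ] X) (C : B.domain →ₗ[ℂ] Y) : Prop :=
  ∃ M : ℝ, ∀ x : B.domain, ‖C x‖ ≤ M * (‖(x : X)‖ + ‖B x‖)

/-- `(s + B)⁻¹ x`, whenever `s + B` is a bijection of `D(B)` onto `X`. -/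
noncomputable def invAdd {X : Type*} [NormedAddCommGroup X] [NormedSpace ℂ X]
    (B : X →ₗ.[ℂ] X) (s : ℝ) (x : X) : X :=
  (Function.invFun (fun z : (B.addScalar s).domain => B.addScalar s z) x :
    (B.addScalar s).domain)

/-- `x` belongs to the domain of `B^{-1/2}` and `B^{-1/2} x = y`, by the Balakrishnan formula
`B^{-1/2} x = (1/π) ∫₀^∞ s^{-1/2} (s + B)⁻¹ x ds`, the integral being improper at `0`.
For an injective m-accretive (more generally, sectorial) operator `B` on a Hilbert space this is
the inverse of the square root of `B`, with its full domain; if `B` is boundedly invertible, the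
integral converges absolutely for all `x` in `X`. -/
def HasNegSqrt {X : Type*} [NormedAddCommGroup X] [NormedSpace ℂ X]
    (B : X →ₗ.[ℂ] X) (x y : X) : Prop :=
  Tendsto
    (fun ε : ℝ => (Real.pi⁻¹ : ℝ) • ∫ s in Set.Ioi ε, (s ^ (-(1 / 2) : ℝ) : ℝ) • B.invAdd s x)
    (𝓝[>] 0) (𝓝 y)

end LinearPMap

/-!
Replacing `T` by `t ↦ e^{-ωt} T(t)` turns `A + ω` into `A`, and accretivity makes the new semigroup
contractive. Write `P` for `A^{-1/2}`, which is then everywhere defined and bounded.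

The heart of the matter is the estimate `‖P y‖² ≤ K ∫₀^η ‖T(t)y‖² dt`. Suppose first that `T`
decays exponentially. As `P = π^{-1/2} ∫₀^∞ u^{-1/2} T(u) du`, the Cauchy–Schwarz inequality just
fails to give the estimate with `η = ∞`. On a Hilbert space, however, the increment
`‖x‖² - ‖T(τ)x‖²` is itself a square `‖D x‖²` with `D` linear, and telescoping yields
`∫₀^∞ t ‖D T(t)y‖² dt ≤ τ ∫₀^∞ ‖T(t)y‖² dt`, with exactly the weight for which `u^{-1/2}` acts
boundedly into `L²(dt)`. Hence `∫₀^τ ‖T(t)Py‖² dt = ∫₀^∞ ‖D T(t)Py‖² dt ≤ K τ ∫₀^∞ ‖T(t)y‖² dt`,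
and `τ → 0` gives the estimate. In general this applies to the part `∫_1^∞ s^{-1/2} (s + A)⁻¹ ds`
of `πP`, and the remaining part is controlled on the finite interval by contractivity.

The lower bound for `C P` on `D(A)`, applied at `(1 + A)⁻¹ T(t)y`, now gives
`δ² ‖(1 + A)⁻¹ P y‖² ≤ K ∫₀^η ‖C (1 + A)⁻¹ T(t) P y‖² dt`. By accretivity `P` has dense range, so
`P y` may be replaced by an arbitrary vector, in particular by `(1 + A) x`.
-/

open Set
open scoped ENNReal InnerProductSpace

section WeightedHardy

variable {α : Type*} [MeasurableSpace α] {μ : Measure α}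

theorem sq_lintegral_le_mul_lintegral {f g h : α → ℝ≥0∞} (hf : AEMeasurable f μ)
    (hg : AEMeasurable g μ) (hfg : ∀ᵐ a ∂μ, h a ^ 2 ≤ f a * g a) :
    (∫⁻ a, h a ∂μ) ^ 2 ≤ (∫⁻ a, f a ∂μ) * ∫⁻ a, g a ∂μ := by
  have sq_sqrt (a : ℝ≥0∞) : (a ^ (1 / 2 : ℝ)) ^ 2 = a := by
    rw [← ENNReal.rpow_natCast, ← ENNReal.rpow_mul]
    norm_num
  have h_le : ∀ᵐ a ∂μ, h a ≤ f a ^ (1 / 2 : ℝ) * g a ^ (1 / 2 : ℝ) := by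
    filter_upwards [hfg] with a ha
    rwa [← ENNReal.pow_le_pow_left_iff two_ne_zero, mul_pow, sq_sqrt, sq_sqrt]
  have holder := ENNReal.lintegral_mul_le_Lp_mul_Lq μ Real.HolderConjugate.two_two
    (hf.pow_const (1 / 2 : ℝ)) (hg.pow_const (1 / 2 : ℝ))
  calc (∫⁻ a, h a ∂μ) ^ 2
      ≤ (∫⁻ a, f a ^ (1 / 2 : ℝ) * g a ^ (1 / 2 : ℝ) ∂μ) ^ 2 := by
        exact pow_le_pow_left₀ zero_le (lintegral_mono_ae h_le) 2
    _ ≤ ((∫⁻ a, f a ∂μ) ^ (1 / 2 : ℝ) * (∫⁻ a, g a ∂μ) ^ (1 / 2 : ℝ)) ^ 2 := by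
        gcongr
        simpa only [Pi.mul_apply, ENNReal.rpow_two, sq_sqrt] using holder
    _ = (∫⁻ a, f a ∂μ) * ∫⁻ a, g a ∂μ := by rw [mul_pow, sq_sqrt, sq_sqrt]

theorem lintegral_Ioc_rpow_neg_half {a : ℝ} (ha : 0 ≤ a) :
    ∫⁻ u in Ioc 0 a, ENNReal.ofReal (u ^ (-(1 / 2) : ℝ)) =
      ENNReal.ofReal (2 * a ^ (1 / 2 : ℝ)) := by
  have hi : IntervalIntegrable (fun u : ℝ => u ^ (-(1 / 2) : ℝ)) volume 0 a :=
    intervalIntegral.intervalIntegrable_rpow' (by norm_num)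
  rw [← ofReal_integral_eq_lintegral_ofReal
    ((intervalIntegrable_iff_integrableOn_Ioc_of_le ha).1 hi),
    ← intervalIntegral.integral_of_le ha, integral_rpow (Or.inl (by norm_num))]
  · congr 1
    rw [Real.zero_rpow (by norm_num)]
    norm_num
    ring
  · filter_upwards [ae_restrict_mem measurableSet_Ioc] with u hu
    exact Real.rpow_nonneg hu.1.le _

theorem lintegral_Ioi_rpow_neg_three_half {a : ℝ} (ha : 0 < a) :
    ∫⁻ u in Ioi a, ENNReal.ofReal (u ^ (-(3 / 2) : ℝ)) =
      ENNReal.ofReal (2 * a ^ (-(1 / 2) : ℝ)) := by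
  rw [← ofReal_integral_eq_lintegral_ofReal (integrableOn_Ioi_rpow_of_lt (by norm_num) ha),
    integral_Ioi_rpow_of_lt (by norm_num) ha]
  · congr 1
    norm_num
    ring
  · filter_upwards [ae_restrict_mem measurableSet_Ioi] with u hu
    exact Real.rpow_nonneg (ha.trans hu).le _

/-- The kernel `u ↦ u ^ (-1/2)` of the half-order fractional integral, extended by zero to the
half-line `u ≤ 0` so that convolutions with it can be written over all of `ℝ`. -/
noncomputable def invSqrtKernel : ℝ → ℝ≥0∞ :=
  (Ioi 0).indicator fun u => ENNReal.ofReal (u ^ (-(1 / 2) : ℝ))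

theorem measurable_invSqrtKernel : Measurable invSqrtKernel :=
  Measurable.indicator (by fun_prop) measurableSet_Ioi

theorem invSqrtKernel_of_pos {u : ℝ} (hu : 0 < u) :
    invSqrtKernel u = ENNReal.ofReal (u ^ (-(1 / 2) : ℝ)) :=
  indicator_of_mem (mem_Ioi.2 hu) _

theorem invSqrtKernel_of_nonpos {u : ℝ} (hu : u ≤ 0) : invSqrtKernel u = 0 :=
  indicator_of_notMem (notMem_Ioi.2 hu) _

theorem invSqrtKernel_mul_ofReal_inv_le {t : ℝ} (ht : 0 < t) (u : ℝ) :
    invSqrtKernel u * ENNReal.ofReal (t + u)⁻¹ ≤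
      (Ioc 0 t).indicator (fun u => ENNReal.ofReal t⁻¹ * ENNReal.ofReal (u ^ (-(1 / 2) : ℝ))) u +
      (Ioi t).indicator (fun u => ENNReal.ofReal (u ^ (-(3 / 2) : ℝ))) u := by
  rcases le_or_gt u 0 with hu | hu
  · simp [invSqrtKernel_of_nonpos hu]
  rw [invSqrtKernel_of_pos hu]
  rcases le_or_gt u t with hut | hut
  · rw [indicator_of_mem (show u ∈ Ioc 0 t from ⟨hu, hut⟩), mul_comm]
    refine le_add_right ?_
    gcongr
    linarith
  · rw [indicator_of_mem (show u ∈ Ioi t from hut), ← ENNReal.ofReal_mul (by positivity)]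
    refine le_add_left (ENNReal.ofReal_le_ofReal ?_)
    rw [show (-(3 / 2) : ℝ) = -(1 / 2) + -1 by norm_num, Real.rpow_add hu, Real.rpow_neg_one]
    gcongr
    linarith

theorem lintegral_invSqrtKernel_mul_ofReal_inv_le {t : ℝ} (ht : 0 < t) :
    ∫⁻ u, invSqrtKernel u * ENNReal.ofReal (t + u)⁻¹ ≤ 4 * invSqrtKernel t := by
  refine (lintegral_mono (invSqrtKernel_mul_ofReal_inv_le ht)).trans ?_
  rw [lintegral_add_left (Measurable.indicator (by fun_prop) measurableSet_Ioc),
    lintegral_indicator measurableSet_Ioc, lintegral_indicator measurableSet_Ioi,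
    lintegral_const_mul _ (by fun_prop), lintegral_Ioc_rpow_neg_half ht.le,
    lintegral_Ioi_rpow_neg_three_half ht, invSqrtKernel_of_pos ht,
    ← ENNReal.ofReal_mul (by positivity), ← ENNReal.ofReal_add (by positivity) (by positivity),
    ← ENNReal.ofReal_ofNat 4, ← ENNReal.ofReal_mul (by norm_num)]
  refine ENNReal.ofReal_le_ofReal (le_of_eq ?_)
  have h_half : t ^ (1 / 2 : ℝ) = t * t ^ (-(1 / 2) : ℝ) := by
    nth_rw 2 [← Real.rpow_one t]
    rw [← Real.rpow_add ht]
    norm_num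
  rw [h_half]
  field_simp
  norm_num

theorem lintegral_invSqrtKernel_mul_invSqrtKernel_sub_le {v : ℝ} (hv : 0 < v) :
    ∫⁻ t, invSqrtKernel t * invSqrtKernel (v - t) ≤ 4 := by
  set c := ENNReal.ofReal ((v / 2) ^ (-(1 / 2) : ℝ)) with hc
  set φ : ℝ → ℝ≥0∞ :=
    (Ioc 0 (v / 2)).indicator fun u => ENNReal.ofReal (u ^ (-(1 / 2) : ℝ)) with hφ
  have hφm : Measurable φ := Measurable.indicator (by fun_prop) measurableSet_Ioc
  have left_half {t : ℝ} (ht : 0 < t) (htv : t ≤ v / 2) :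
      invSqrtKernel t * invSqrtKernel (v - t) ≤ c * φ t := by
    rw [invSqrtKernel_of_pos ht, invSqrtKernel_of_pos (by linarith), hφ,
      indicator_of_mem (show t ∈ Ioc 0 (v / 2) from ⟨ht, htv⟩), mul_comm]
    refine mul_le_mul_left (ENNReal.ofReal_le_ofReal ?_) _
    exact Real.rpow_le_rpow_of_nonpos (by positivity) (by linarith) (by norm_num)
  have both_halves (t : ℝ) :
      invSqrtKernel t * invSqrtKernel (v - t) ≤ c * (φ t + φ (v - t)) := by
    rcases le_or_gt t 0 with ht | ht
    · simp [invSqrtKernel_of_nonpos ht]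
    rcases le_or_gt v t with htv | htv
    · simp [invSqrtKernel_of_nonpos (sub_nonpos.2 htv)]
    rcases le_total t (v / 2) with h | h
    · exact (left_half ht h).trans (by gcongr; exact le_self_add)
    · have h_refl := left_half (t := v - t) (by linarith) (by linarith)
      rw [sub_sub_cancel, mul_comm] at h_refl
      exact h_refl.trans (by gcongr; exact le_add_self)
  refine (lintegral_mono both_halves).trans ?_
  rw [lintegral_const_mul _ (by fun_prop), lintegral_add_left hφm,
    lintegral_sub_left_eq_self φ v, hφ, lintegral_indicator measurableSet_Ioc,
    lintegral_Ioc_rpow_neg_half (by positivity), hc, ← ENNReal.ofReal_add (by positivity)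
    (by positivity), ← ENNReal.ofReal_mul (by positivity), ← ENNReal.ofReal_ofNat 4]
  refine ENNReal.ofReal_le_ofReal (le_of_eq ?_)
  have h_cancel : (v / 2) ^ (-(1 / 2) : ℝ) * (v / 2) ^ (1 / 2 : ℝ) = 1 := by
    rw [← Real.rpow_add (by positivity)]
    norm_num
  linear_combination 4 * h_cancel

theorem sq_lintegral_invSqrtKernel_mul_le {H : ℝ → ℝ≥0∞} (hH : Measurable H) {t : ℝ}
    (ht : 0 < t) :
    (∫⁻ u, invSqrtKernel u * H (t + u)) ^ 2 ≤
      4 * ∫⁻ v in Ioi 0, invSqrtKernel t * invSqrtKernel (v - t) *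
        (ENNReal.ofReal v * H v ^ 2) := by
  have hk := measurable_invSqrtKernel
  set G : ℝ → ℝ≥0∞ := fun v => ENNReal.ofReal v * H v ^ 2
  have split (u : ℝ) : (invSqrtKernel u * H (t + u)) ^ 2 ≤
      invSqrtKernel u * ENNReal.ofReal (t + u)⁻¹ * (invSqrtKernel u * G (t + u)) := by
    rcases le_or_gt u 0 with hu | hu
    · simp [invSqrtKernel_of_nonpos hu]
    have htu : 0 < t + u := add_pos ht hu
    refine le_of_eq ?_
    calc (invSqrtKernel u * H (t + u)) ^ 2
        = ENNReal.ofReal ((t + u)⁻¹ * (t + u)) * (invSqrtKernel u * H (t + u)) ^ 2 := by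
          rw [inv_mul_cancel₀ htu.ne', ENNReal.ofReal_one, one_mul]
      _ = _ := by
          rw [ENNReal.ofReal_mul (by positivity)]
          ring
  have shift : ∫⁻ u, invSqrtKernel u * G (t + u) =
      ∫⁻ v in Ioi 0, invSqrtKernel (v - t) * G v := by
    rw [← lintegral_indicator measurableSet_Ioi,
      ← lintegral_add_left_eq_self ((Ioi 0).indicator fun v => invSqrtKernel (v - t) * G v) t]
    refine lintegral_congr fun u => ?_
    rcases le_or_gt u 0 with hu | hu
    · simp [indicator, invSqrtKernel_of_nonpos hu]
    · simp [indicator, add_pos ht hu]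
  refine (sq_lintegral_le_mul_lintegral (by fun_prop) (by fun_prop)
    (Eventually.of_forall split)).trans ?_
  simp only [mul_assoc (invSqrtKernel t)]
  rw [shift, lintegral_const_mul _ (by fun_prop), ← mul_assoc]
  gcongr
  exact lintegral_invSqrtKernel_mul_ofReal_inv_le ht

theorem lintegral_sq_lintegral_invSqrtKernel_mul_le {H : ℝ → ℝ≥0∞} (hH : Measurable H) :
    ∫⁻ t in Ioi 0, (∫⁻ u, invSqrtKernel u * H (t + u)) ^ 2 ≤
      16 * ∫⁻ v in Ioi 0, ENNReal.ofReal v * H v ^ 2 := by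
  have hk := measurable_invSqrtKernel
  calc ∫⁻ t in Ioi 0, (∫⁻ u, invSqrtKernel u * H (t + u)) ^ 2
      ≤ ∫⁻ t in Ioi 0, 4 * ∫⁻ v in Ioi 0, invSqrtKernel t * invSqrtKernel (v - t) *
          (ENNReal.ofReal v * H v ^ 2) :=
        setLIntegral_mono' measurableSet_Ioi fun t ht => sq_lintegral_invSqrtKernel_mul_le hH ht
    _ ≤ ∫⁻ t, 4 * ∫⁻ v in Ioi 0, invSqrtKernel t * invSqrtKernel (v - t) *
          (ENNReal.ofReal v * H v ^ 2) := setLIntegral_le_lintegral _ _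
    _ = 4 * ∫⁻ v in Ioi 0, ∫⁻ t, invSqrtKernel t * invSqrtKernel (v - t) *
          (ENNReal.ofReal v * H v ^ 2) := by
        rw [lintegral_const_mul' _ _ (by simp),
          lintegral_lintegral_swap (by unfold Function.uncurry; fun_prop)]
    _ ≤ 4 * ∫⁻ v in Ioi 0, 4 * (ENNReal.ofReal v * H v ^ 2) := by
        refine mul_le_mul_right (setLIntegral_mono' measurableSet_Ioi fun v hv => ?_) _
        rw [lintegral_mul_const _ (by fun_prop)]
        gcongr
        exact lintegral_invSqrtKernel_mul_invSqrtKernel_sub_le hv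
    _ = 16 * ∫⁻ v in Ioi 0, ENNReal.ofReal v * H v ^ 2 := by
        rw [lintegral_const_mul _ (by fun_prop), ← mul_assoc]
        norm_num

end WeightedHardy

section DecreasingIncrements

theorem lintegral_Ioi_comp_add_right (f : ℝ → ℝ≥0∞) (τ : ℝ) :
    ∫⁻ u in Ioi 0, f (u + τ) = ∫⁻ u in Ioi τ, f u := by
  have h := (measurePreserving_add_right volume τ).setLIntegral_comp_preimage_emb
    (measurableEmbedding_addRight τ) f (Ioi τ)
  rwa [preimage_add_const_Ioi, sub_self] at h

theorem lintegral_Ioc_add_lintegral_Ioi (f : ℝ → ℝ≥0∞) {τ : ℝ} (hτ : 0 ≤ τ) :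
    (∫⁻ u in Ioc 0 τ, f u) + ∫⁻ u in Ioi τ, f u = ∫⁻ u in Ioi 0, f u := by
  rw [← Ioc_union_Ioi_eq_Ioi hτ,
    lintegral_union measurableSet_Ioi (Ioc_disjoint_Ioi le_rfl)]

variable {n d : ℝ → ℝ≥0∞} {τ : ℝ}

theorem lintegral_increment_eq (hd : Measurable d) (hτ : 0 ≤ τ)
    (hdn : ∀ u ∈ Ioi 0, d u + n (u + τ) = n u) (hn_fin : ∫⁻ u in Ioi 0, n u ≠ ∞) :
    ∫⁻ u in Ioi 0, d u = ∫⁻ u in Ioc 0 τ, n u := by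
  have split := lintegral_Ioc_add_lintegral_Ioi n hτ
  have h_tail : ∫⁻ u in Ioi τ, n u ≠ ∞ :=
    ne_top_of_le_ne_top hn_fin (split ▸ le_add_self)
  rw [← ENNReal.add_left_inj h_tail, split, ← lintegral_Ioi_comp_add_right n τ,
    ← lintegral_add_left hd]
  exact setLIntegral_congr_fun measurableSet_Ioi hdn

theorem lintegral_mul_increment_le (hn : Measurable n) (hd : Measurable d) (hτ : 0 ≤ τ)
    (hdn : ∀ u ∈ Ioi 0, d u + n (u + τ) = n u)
    (hn_fin : ∫⁻ u in Ioi 0, ENNReal.ofReal u * n u ≠ ∞) :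
    ∫⁻ u in Ioi 0, ENNReal.ofReal u * d u ≤ ENNReal.ofReal τ * ∫⁻ u in Ioi 0, n u := by
  have h_add : (∫⁻ u in Ioi 0, ENNReal.ofReal u * d u) +
      ∫⁻ u in Ioi 0, ENNReal.ofReal u * n (u + τ) = ∫⁻ u in Ioi 0, ENNReal.ofReal u * n u := by
    rw [← lintegral_add_left (by fun_prop)]
    exact setLIntegral_congr_fun measurableSet_Ioi fun u hu => by rw [← mul_add, hdn u hu]
  have h_fin : ∫⁻ u in Ioi 0, ENNReal.ofReal u * n (u + τ) ≠ ∞ :=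
    ne_top_of_le_ne_top hn_fin (h_add ▸ le_add_self)
  have h_head : ∫⁻ u in Ioc 0 τ, ENNReal.ofReal u * n u ≤
      ENNReal.ofReal τ * ∫⁻ u in Ioc 0 τ, n u := by
    rw [← lintegral_const_mul _ hn]
    exact setLIntegral_mono' measurableSet_Ioc fun u hu => by gcongr; exact hu.2
  have h_tail : ∫⁻ u in Ioi τ, ENNReal.ofReal u * n u =
      ENNReal.ofReal τ * (∫⁻ u in Ioi τ, n u) +
        ∫⁻ u in Ioi 0, ENNReal.ofReal u * n (u + τ) := by
    rw [← lintegral_Ioi_comp_add_right, ← lintegral_Ioi_comp_add_right n,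
      ← lintegral_const_mul _ (by fun_prop), ← lintegral_add_left (by fun_prop)]
    refine setLIntegral_congr_fun measurableSet_Ioi fun u hu => ?_
    rw [add_comm u τ, ENNReal.ofReal_add hτ (le_of_lt hu), add_mul]
  refine (ENNReal.add_le_add_iff_right h_fin).1 ?_
  calc _ = (∫⁻ u in Ioc 0 τ, ENNReal.ofReal u * n u) +
        ∫⁻ u in Ioi τ, ENNReal.ofReal u * n u := by
        rw [h_add, lintegral_Ioc_add_lintegral_Ioi _ hτ]
    _ ≤ ENNReal.ofReal τ * (∫⁻ u in Ioc 0 τ, n u) + (ENNReal.ofReal τ * (∫⁻ u in Ioi τ, n u) +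
        ∫⁻ u in Ioi 0, ENNReal.ofReal u * n (u + τ)) := add_le_add h_head h_tail.le
    _ = _ := by rw [← add_assoc, ← mul_add, lintegral_Ioc_add_lintegral_Ioi _ hτ]

end DecreasingIncrements

section Contraction

variable {X : Type*} [NormedAddCommGroup X] [InnerProductSpace ℂ X] [CompleteSpace X]

theorem inner_star_mul_self_apply_self (W : X →L[ℂ] X) (x : X) :
    ⟪(star W * W) x, x⟫_ℂ = (‖W x‖ ^ 2 : ℝ) := by
  rw [ContinuousLinearMap.star_eq_adjoint, mul_apply_eq_comp,
    ContinuousLinearMap.adjoint_inner_left, inner_self_eq_norm_sq_to_K]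
  push_cast
  rfl

theorem exists_norm_sq_add_norm_sq_eq {V : X →L[ℂ] X} (hV : ∀ x, ‖V x‖ ≤ ‖x‖) :
    ∃ D : X →L[ℂ] X, ∀ x, ‖D x‖ ^ 2 + ‖V x‖ ^ 2 = ‖x‖ ^ 2 := by
  have h_inner (x : X) : ⟪(1 - star V * V) x, x⟫_ℂ = (‖x‖ ^ 2 - ‖V x‖ ^ 2 : ℝ) := by
    rw [sub_apply, inner_sub_left, inner_star_mul_self_apply_self, one_apply_eq_self,
      inner_self_eq_norm_sq_to_K]
    push_cast
    rfl
  have h_pos : 0 ≤ 1 - star V * V := by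
    rw [ContinuousLinearMap.nonneg_iff_isPositive, ContinuousLinearMap.isPositive_iff_complex]
    intro x
    simp only [h_inner, RCLike.re_eq_complex_re, Complex.ofReal_re, true_and, sub_nonneg]
    exact pow_le_pow_left₀ (norm_nonneg _) (hV x) 2
  obtain ⟨D, hD⟩ := CStarAlgebra.nonneg_iff_eq_star_mul_self.1 h_pos
  refine ⟨D, fun x => ?_⟩
  have h_norm := h_inner x
  rw [hD, inner_star_mul_self_apply_self] at h_norm
  rw [← eq_sub_iff_add_eq]
  exact_mod_cast h_norm

end Contraction

section Graph

variable {X : Type*} [NormedAddCommGroup X] [NormedSpace ℂ X] {B : X →ₗ.[ℂ] X} {x z : X}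

theorem mem_graph_neg_iff : (x, z) ∈ (-B).graph ↔ (x, -z) ∈ B.graph := by
  simp only [LinearPMap.mem_graph_iff, LinearPMap.neg_apply, neg_eq_iff_eq_neg]
  rfl

theorem mem_graph_addScalar_iff {c : ℝ} :
    (x, z) ∈ (B.addScalar c).graph ↔ (x, z - c • x) ∈ B.graph := by
  simp only [LinearPMap.mem_graph_iff]
  constructor
  · rintro ⟨y, rfl, rfl⟩
    exact ⟨y, rfl, (add_sub_cancel_left (c • (y : X)) (B y)).symm⟩
  · rintro ⟨y, rfl, hy⟩
    exact ⟨y, rfl, (congrArg (c • (y : X) + ·) hy).trans (add_sub_cancel _ _)⟩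

end Graph

theorem hasDerivWithinAt_exp_mul_smul {E : Type*} [NormedAddCommGroup E] [NormedSpace ℝ E]
    {f : ℝ → E} {f' : E} {s : Set ℝ} {t : ℝ} (hf : HasDerivWithinAt f f' s t) (c : ℝ) :
    HasDerivWithinAt (fun r => Real.exp (c * r) • f r)
      (Real.exp (c * t) • (f' + c • f t)) s t := by
  have h_exp :
      HasDerivWithinAt (fun r : ℝ => Real.exp (c * r)) (Real.exp (c * t) * (c * 1)) s t :=
    ((hasDerivAt_id t).const_mul c).exp.hasDerivWithinAt
  refine (h_exp.smul hf).congr_deriv ?_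
  module

namespace C0Semigroup

section Orbit

variable {X : Type*} [NormedAddCommGroup X] [NormedSpace ℂ X] (T : C0Semigroup X)

theorem op_comm (s t : ℝ≥0) (x : X) : T.op s (T.op t x) = T.op t (T.op s x) := by
  simp only [← ContinuousLinearMap.comp_apply, ← T.op_add, add_comm]

/-- The orbit `t ↦ T(t)x` as a function of a real variable, extended by the constant `x` to
`t ≤ 0`. -/
def orbit (x : X) (t : ℝ) : X := T.op t.toNNReal x

@[fun_prop]
theorem continuous_orbit (x : X) : Continuous (T.orbit x) :=
  (T.strongly_continuous x).comp continuous_real_toNNReal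

@[simp]
theorem orbit_zero (x : X) : T.orbit x 0 = x := by
  rw [orbit, Real.toNNReal_zero, T.op_zero, ContinuousLinearMap.id_apply]

theorem orbit_add {s t : ℝ} (hs : 0 ≤ s) (ht : 0 ≤ t) (x : X) :
    T.orbit x (s + t) = T.op s.toNNReal (T.orbit x t) := by
  rw [orbit, Real.toNNReal_add hs ht, T.op_add, ContinuousLinearMap.comp_apply, orbit]

theorem orbit_op (s : ℝ≥0) (x : X) (t : ℝ) : T.orbit (T.op s x) t = T.op s (T.orbit x t) :=
  T.op_comm _ _ x

theorem diffQuot_toNNReal (x : X) {t : ℝ} (ht : 0 ≤ t) :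
    T.diffQuot x t.toNNReal = t⁻¹ • (T.orbit x t - x) := by
  rw [diffQuot, Complex.coe_smul, Real.coe_toNNReal t ht, orbit]

theorem tendsto_diffQuot_iff_hasDerivWithinAt {x z : X} :
    Tendsto (T.diffQuot x) (𝓝[>] 0) (𝓝 z) ↔ HasDerivWithinAt (T.orbit x) z (Ici 0) 0 := by
  have h_coe : Tendsto ((↑) : ℝ≥0 → ℝ) (𝓝[>] 0) (𝓝[>] 0) :=
    NNReal.continuous_coe.continuousWithinAt.tendsto_nhdsWithin fun _ => NNReal.coe_pos.2
  have h_toNNReal : Tendsto Real.toNNReal (𝓝[>] 0) (𝓝[>] 0) := by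
    simpa only [Real.toNNReal_zero] using
      continuous_real_toNNReal.continuousWithinAt.tendsto_nhdsWithin (s := Ioi 0) (t := Ioi 0)
        (x := 0) fun _ => Real.toNNReal_pos.2
  rw [← hasDerivWithinAt_Ioi_iff_Ici, hasDerivWithinAt_iff_tendsto_slope' self_notMem_Ioi]
  have h_slope {t : ℝ} (ht : 0 ≤ t) : slope (T.orbit x) 0 t = T.diffQuot x t.toNNReal := by
    rw [slope_def_module, sub_zero, orbit_zero, T.diffQuot_toNNReal x ht]
  refine ⟨fun h => (h.comp h_toNNReal).congr' ?_, fun h => (h.comp h_coe).congr fun t => ?_⟩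
  · filter_upwards [self_mem_nhdsWithin] with t ht using (h_slope (le_of_lt ht)).symm
  · rw [Function.comp_apply, h_slope t.coe_nonneg, Real.toNNReal_coe]

theorem mem_graph_generator_iff {x z : X} :
    (x, z) ∈ T.generator.graph ↔ HasDerivWithinAt (T.orbit x) z (Ici 0) 0 := by
  rw [← tendsto_diffQuot_iff_hasDerivWithinAt, LinearPMap.mem_graph_iff]
  have h_spec (y : T.generator.domain) :
      Tendsto (T.diffQuot y) (𝓝[>] 0) (𝓝 (T.generator y)) := y.2.choose_spec
  constructor
  · rintro ⟨y, rfl, rfl⟩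
    exact h_spec y
  · intro h
    exact ⟨⟨x, z, h⟩, rfl, tendsto_nhds_unique (h_spec ⟨x, z, h⟩) h⟩

variable {T} {B : X →ₗ.[ℂ] X} (hB : T.generator = -B) {x z : X}

include hB

theorem mem_graph_iff_hasDerivWithinAt :
    (x, z) ∈ B.graph ↔ HasDerivWithinAt (T.orbit x) (-z) (Ici 0) 0 := by
  rw [← mem_graph_generator_iff, hB, mem_graph_neg_iff, neg_neg]

theorem op_mem_graph (s : ℝ≥0) (h : (x, z) ∈ B.graph) : (T.op s x, T.op s z) ∈ B.graph := by
  rw [mem_graph_iff_hasDerivWithinAt hB] at h ⊢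
  rw [← map_neg, funext (T.orbit_op s x)]
  exact ((T.op s).restrictScalars ℝ).hasFDerivAt.comp_hasDerivWithinAt 0 h

theorem apply_onDomain (s : ℝ≥0) (x : B.domain) : B (T.onDomain hB s x) = T.op s (B x) :=
  B.mem_graph_snd_inj (B.mem_graph _) (op_mem_graph hB s (B.mem_graph x)) rfl

theorem hasDerivWithinAt_orbit (h : (x, z) ∈ B.graph) {t : ℝ} (ht : 0 ≤ t) :
    HasDerivWithinAt (T.orbit x) (-T.orbit z t) (Ici t) t := by
  have h_shift : HasDerivWithinAt (fun r => T.orbit (T.orbit x t) (r - t)) (-T.orbit z t)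
      (Ici t) t := by
    have h_zero := (mem_graph_iff_hasDerivWithinAt hB).1 (op_mem_graph hB t.toNNReal h)
    rw [← sub_self t] at h_zero
    have h_comp := HasDerivWithinAt.scomp (h := (· - t)) t h_zero
      ((hasDerivWithinAt_id t (Ici t)).sub_const t) fun r hr => sub_le_sub_right (mem_Ici.1 hr) t
    rw [one_smul] at h_comp
    exact h_comp
  refine h_shift.congr (fun r hr => ?_) ?_
  · have h_add := T.orbit_add (sub_nonneg.2 hr) ht x
    rwa [sub_add_cancel] at h_add
  · rw [sub_self, orbit_zero]

theorem sub_orbit_eq_integral [CompleteSpace X] (h : (x, z) ∈ B.graph) {t : ℝ} (ht : 0 ≤ t) :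
    x - T.orbit x t = ∫ r in (0 : ℝ)..t, T.orbit z r := by
  have h_ftc := intervalIntegral.integral_eq_sub_of_hasDeriv_right_of_le ht
    (T.continuous_orbit x).continuousOn
    (fun r hr => (hasDerivWithinAt_orbit hB h hr.1.le).Ioi_of_Ici)
    ((T.continuous_orbit z).neg.intervalIntegrable _ _)
  rw [intervalIntegral.integral_neg, orbit_zero] at h_ftc
  rw [← neg_sub, ← h_ftc, neg_neg]

theorem integral_orbit_mem_graph [CompleteSpace X] (x : X) {l : ℝ} (hl : 0 ≤ l) :
    (∫ u in (0 : ℝ)..l, T.orbit x u, x - T.orbit x l) ∈ B.graph := by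
  have hi (a b : ℝ) : IntervalIntegrable (T.orbit x) volume a b :=
    (T.continuous_orbit x).intervalIntegrable a b
  have h_orbit {t : ℝ} (ht : 0 ≤ t) : T.orbit (∫ u in (0 : ℝ)..l, T.orbit x u) t =
      (∫ u in (0 : ℝ)..(t + l), T.orbit x u) - ∫ u in (0 : ℝ)..t, T.orbit x u := by
    rw [intervalIntegral.integral_interval_sub_left (hi _ _) (hi _ _), orbit,
      ← ContinuousLinearMap.intervalIntegral_comp_comm _ (hi _ _)]
    calc ∫ u in (0 : ℝ)..l, T.op t.toNNReal (T.orbit x u)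
        = ∫ u in (0 : ℝ)..l, T.orbit x (t + u) :=
          intervalIntegral.integral_congr fun u hu =>
            (T.orbit_add ht (uIcc_of_le hl ▸ hu).1 x).symm
      _ = ∫ u in t..(t + l), T.orbit x u := by
          rw [intervalIntegral.integral_comp_add_left, add_zero]
  have h_primitive (b : ℝ) :
      HasDerivAt (fun t => ∫ u in (0 : ℝ)..t, T.orbit x u) (T.orbit x b) b :=
    intervalIntegral.integral_hasDerivAt_right (hi _ _)
      (T.continuous_orbit x).aestronglyMeasurable.stronglyMeasurableAtFilter
      (T.continuous_orbit x).continuousAt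
  rw [mem_graph_iff_hasDerivWithinAt hB, neg_sub]
  have h_deriv := ((h_primitive (0 + l)).comp_add_const 0 l).sub (h_primitive 0)
  rw [zero_add, orbit_zero] at h_deriv
  exact h_deriv.hasDerivWithinAt.congr (fun t ht => h_orbit ht) (h_orbit le_rfl)

theorem dense_domain [CompleteSpace X] : Dense (B.domain : Set X) := by
  intro x
  have h_deriv : HasDerivAt (fun t => ∫ u in (0 : ℝ)..t, T.orbit x u) x 0 := by
    simpa only [orbit_zero] using (T.continuous_orbit x).integral_hasStrictDerivAt 0 0 |>.hasDerivAt
  have h_lim := h_deriv.tendsto_slope_zero_right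
  simp only [zero_add, intervalIntegral.integral_same, sub_zero] at h_lim
  refine mem_closure_of_tendsto h_lim ?_
  filter_upwards [self_mem_nhdsWithin] with t ht
  rw [← Complex.coe_smul]
  exact B.domain.smul_mem _
    (B.mem_domain_of_mem_graph (integral_orbit_mem_graph hB x (le_of_lt ht)))

end Orbit

section Rescale

variable {X : Type*} [NormedAddCommGroup X] [NormedSpace ℂ X]

/-- The rescaled semigroup `t ↦ e^{-ωt} T(t)`. If `-A` generates `T`, then `-(A + ω)` generates
it. -/
noncomputable def rescale (T : C0Semigroup X) (ω : ℝ) : C0Semigroup X where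
  op t := Real.exp (-ω * t) • T.op t
  op_zero := by rw [NNReal.coe_zero, mul_zero, Real.exp_zero, one_smul, T.op_zero]
  op_add s t := by
    rw [NNReal.coe_add, mul_add, Real.exp_add, T.op_add, ContinuousLinearMap.smul_comp,
      ContinuousLinearMap.comp_smul, smul_smul]
  strongly_continuous x := by
    have := T.strongly_continuous x
    simp only [smul_apply]
    fun_prop

variable (T : C0Semigroup X) (ω : ℝ)

theorem rescale_op_apply (t : ℝ≥0) (x : X) :
    (T.rescale ω).op t x = Real.exp (-ω * t) • T.op t x := rfl

theorem orbit_rescale (x : X) {t : ℝ} (ht : 0 ≤ t) :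
    (T.rescale ω).orbit x t = Real.exp (-ω * t) • T.orbit x t := by
  rw [orbit, rescale_op_apply, Real.coe_toNNReal t ht, orbit]

variable {T}

theorem generator_rescale {A : X →ₗ.[ℂ] X} (hA : T.generator = -A) :
    (T.rescale ω).generator = -(A.addScalar ω) := by
  refine LinearPMap.eq_of_eq_graph (SetLike.ext fun ⟨x, z⟩ => ?_)
  rw [mem_graph_generator_iff, mem_graph_neg_iff, mem_graph_addScalar_iff,
    mem_graph_iff_hasDerivWithinAt hA]
  constructor <;> intro h
  · refine ((hasDerivWithinAt_exp_mul_smul h ω).congr (fun t ht => ?_) ?_).congr_deriv ?_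
    · rw [T.orbit_rescale ω x ht, smul_smul, ← Real.exp_add, neg_mul, add_neg_cancel,
        Real.exp_zero, one_smul]
    · simp
    · simp only [mul_zero, Real.exp_zero, one_smul, orbit_zero]
      abel
  · refine ((hasDerivWithinAt_exp_mul_smul h (-ω)).congr (fun t ht => T.orbit_rescale ω x ht)
      (T.orbit_rescale ω x le_rfl)).congr_deriv ?_
    · simp

end Rescale

section Contractive

variable {X : Type*} [NormedAddCommGroup X]

/-- A semigroup of contractions. -/
def IsContractive [NormedSpace ℂ X] (T : C0Semigroup X) : Prop :=
  ∀ t x, ‖T.op t x‖ ≤ ‖x‖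

theorem IsContractive.rescale [NormedSpace ℂ X] {T : C0Semigroup X} (hT : T.IsContractive)
    {ω : ℝ} (hω : 0 ≤ ω) : (T.rescale ω).IsContractive := fun t x => by
  have h_exp : Real.exp (-ω * t) ≤ 1 :=
    Real.exp_le_one_iff.2 (mul_nonpos_of_nonpos_of_nonneg (neg_nonpos.2 hω) t.2)
  rw [rescale_op_apply, norm_smul, Real.norm_of_nonneg (Real.exp_nonneg _)]
  exact (mul_le_of_le_one_left (norm_nonneg _) h_exp).trans (hT t x)

theorem IsContractive.antitone_norm_orbit [NormedSpace ℂ X] {T : C0Semigroup X}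
    (hT : T.IsContractive) (x : X) : AntitoneOn (fun t => ‖T.orbit x t‖) (Ici 0) := by
  intro s hs t _ hst
  have h_add := T.orbit_add (sub_nonneg.2 hst) hs x
  rw [sub_add_cancel] at h_add
  exact (congrArg norm h_add).trans_le (hT _ _)

variable [InnerProductSpace ℂ X] {T : C0Semigroup X} {B : X →ₗ.[ℂ] X}

theorem norm_op_le_of_isAccretive_of_mem_domain (hB : T.generator = -B) (hacc : B.IsAccretive)
    (t : ℝ≥0) (x : B.domain) : ‖T.op t x‖ ≤ ‖(x : X)‖ := by
  have h_deriv (r : ℝ) (hr : 0 ≤ r) : HasDerivWithinAt (fun r => ‖T.orbit (x : X) r‖ ^ 2)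
      (2 * (inner ℂ (T.orbit (x : X) r) (-T.orbit (B x) r)).re) (Ici r) r := by
    let _ : InnerProductSpace ℝ X := .complexToReal
    have h_norm := HasDerivWithinAt.norm_sq (F := X)
      (hasDerivWithinAt_orbit hB (B.mem_graph x) hr)
    rw [real_inner_eq_re_inner ℂ] at h_norm
    exact h_norm
  have h_nonpos (r : ℝ) :
      2 * (inner ℂ (T.orbit (x : X) r) (-T.orbit (B x) r)).re ≤ 0 := by
    have h_re := hacc (T.onDomain hB r.toNNReal x)
    rw [apply_onDomain, ← inner_conj_symm, Complex.conj_re] at h_re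
    rw [inner_neg_right, Complex.neg_re]
    exact mul_nonpos_of_nonneg_of_nonpos two_pos.le (neg_nonpos.2 h_re)
  have h_sq := image_le_of_deriv_right_le_deriv_boundary (b := t) (B := fun _ => ‖(x : X)‖ ^ 2)
    (B' := fun _ => 0) (by fun_prop) (fun r hr => h_deriv r hr.1) (by simp)
    continuousOn_const (fun r _ => hasDerivWithinAt_const _ _ _) (fun r _ => h_nonpos r)
    (right_mem_Icc.2 t.2)
  simpa only [orbit, Real.toNNReal_coe, sq_le_sq₀, norm_nonneg] using h_sq

theorem isContractive_of_isAccretive [CompleteSpace X] (hB : T.generator = -B)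
    (hacc : B.IsAccretive) : T.IsContractive := fun t x =>
  (dense_domain hB).induction (P := fun x => ‖T.op t x‖ ≤ ‖x‖)
    (fun x hx => norm_op_le_of_isAccretive_of_mem_domain hB hacc t ⟨x, hx⟩)
    (isClosed_le (by fun_prop) (by fun_prop)) x

end Contractive

section Resolvent

variable {X : Type*} [NormedAddCommGroup X] [NormedSpace ℂ X] {T : C0Semigroup X} {s r : ℝ}

theorem IsContractive.norm_orbit_rescale_le (hT : T.IsContractive) (s : ℝ) (x : X) {t : ℝ}
    (ht : 0 ≤ t) : ‖(T.rescale s).orbit x t‖ ≤ Real.exp (-s * t) * ‖x‖ := by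
  rw [T.orbit_rescale s x ht, norm_smul, Real.norm_of_nonneg (Real.exp_nonneg _)]
  exact mul_le_mul_of_nonneg_left (hT _ x) (Real.exp_nonneg _)

theorem IsContractive.integrableOn_orbit_rescale (hT : T.IsContractive) (hs : 0 < s) (x : X) :
    IntegrableOn ((T.rescale s).orbit x) (Ioi 0) :=
  Integrable.mono' ((exp_neg_integrableOn_Ioi 0 hs).mul_const ‖x‖)
    (continuous_orbit _ x).aestronglyMeasurable
    ((ae_restrict_mem measurableSet_Ioi).mono fun _ ht =>
      hT.norm_orbit_rescale_le s x (le_of_lt ht))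

theorem IsContractive.norm_integral_orbit_rescale_le (hT : T.IsContractive) (hs : 0 < s) (x : X) :
    ‖∫ t in Ioi 0, (T.rescale s).orbit x t‖ ≤ s⁻¹ * ‖x‖ := by
  refine (norm_integral_le_of_norm_le ((exp_neg_integrableOn_Ioi 0 hs).mul_const ‖x‖)
    ((ae_restrict_mem measurableSet_Ioi).mono fun _ ht =>
      hT.norm_orbit_rescale_le s x (le_of_lt ht))).trans_eq ?_
  rw [integral_mul_const, integral_exp_mul_Ioi (neg_lt_zero.2 hs)]
  simp

open scoped Classical in
/-- The resolvent `(s + B)⁻¹`, `s > 0`, of the operator `B` such that `-B` generates the contraction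
semigroup `T`, defined as the Laplace transform `∫₀^∞ e^{-st} T(t)x dt`; it is `0` for `s ≤ 0`. -/
noncomputable def IsContractive.resolvent (hT : T.IsContractive) (s : ℝ) : X →L[ℂ] X :=
  if hs : 0 < s then
    LinearMap.mkContinuous
      { toFun := fun x => ∫ t in Ioi 0, (T.rescale s).orbit x t
        map_add' := fun x y => by
          rw [← integral_add (hT.integrableOn_orbit_rescale hs x)
            (hT.integrableOn_orbit_rescale hs y)]
          simp only [orbit, map_add]
        map_smul' := fun c x => by
          simp only [orbit, map_smul, integral_smul, RingHom.id_apply] }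
      s⁻¹ (hT.norm_integral_orbit_rescale_le hs)
  else 0

variable (hT : T.IsContractive)

include hT

theorem IsContractive.resolvent_apply (hs : 0 < s) (x : X) :
    hT.resolvent s x = ∫ t in Ioi 0, (T.rescale s).orbit x t := by
  rw [resolvent, dif_pos hs]
  rfl

theorem IsContractive.norm_resolvent_apply_le (hs : 0 < s) (x : X) :
    ‖hT.resolvent s x‖ ≤ s⁻¹ * ‖x‖ := by
  rw [hT.resolvent_apply hs]
  exact hT.norm_integral_orbit_rescale_le hs x

theorem IsContractive.norm_resolvent_le (hs : 0 < s) : ‖hT.resolvent s‖ ≤ s⁻¹ :=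
  ContinuousLinearMap.opNorm_le_bound _ (inv_nonneg.2 hs.le) (hT.norm_resolvent_apply_le hs)

theorem IsContractive.norm_sub_smul_resolvent_le (hs : 0 < s) (x : X) :
    ‖x - s • hT.resolvent s x‖ ≤ 2 * ‖x‖ := by
  have h_smul : ‖s • hT.resolvent s x‖ ≤ ‖x‖ := by
    rw [norm_smul, Real.norm_of_nonneg hs.le, ← le_inv_mul_iff₀ hs]
    exact hT.norm_resolvent_apply_le hs x
  rw [two_mul]
  exact (norm_sub_le _ _).trans (add_le_add_right h_smul _)

variable [CompleteSpace X]

theorem IsContractive.map_resolvent {Y : Type*} [NormedAddCommGroup Y] [NormedSpace ℂ Y]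
    [CompleteSpace Y] (hs : 0 < s) (L : X →L[ℂ] Y) (x : X) :
    L (hT.resolvent s x) = ∫ t in Ioi 0, L ((T.rescale s).orbit x t) := by
  rw [hT.resolvent_apply hs, L.integral_comp_comm (hT.integrableOn_orbit_rescale hs x)]

theorem IsContractive.map_resolvent_of_comm (hs : 0 < s) (L : X →L[ℂ] X)
    (hL : ∀ t x, L (T.op t x) = T.op t (L x)) (x : X) :
    L (hT.resolvent s x) = hT.resolvent s (L x) := by
  rw [hT.map_resolvent hs, hT.resolvent_apply hs]
  simp only [orbit, rescale_op_apply, L.map_smul_of_tower, hL]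

theorem IsContractive.op_resolvent (hs : 0 < s) (t : ℝ≥0) (x : X) :
    T.op t (hT.resolvent s x) = hT.resolvent s (T.op t x) :=
  hT.map_resolvent_of_comm hs (T.op t) (T.op_comm t) x

theorem IsContractive.orbit_rescale_resolvent (hs : 0 < s) (x : X) {t : ℝ} (ht : 0 ≤ t) :
    (T.rescale s).orbit (hT.resolvent s x) t =
      hT.resolvent s x - ∫ u in (0 : ℝ)..t, (T.rescale s).orbit x u := by
  have h_tail : ∫ u in Ioi t, (T.rescale s).orbit x u =
      hT.resolvent s x - ∫ u in (0 : ℝ)..t, (T.rescale s).orbit x u := by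
    have h_int := hT.integrableOn_orbit_rescale hs x
    rw [hT.resolvent_apply hs, ← intervalIntegral.integral_interval_add_Ioi h_int
      (h_int.mono_set (Ioi_subset_Ioi ht)), add_sub_cancel_left]
  have h_translate := (measurePreserving_add_left volume t).setIntegral_preimage_emb
    (measurableEmbedding_addLeft t) ((T.rescale s).orbit x) (Ioi t)
  rw [← h_tail, ← h_translate, orbit, hT.map_resolvent hs, preimage_const_add_Ioi, sub_self]
  exact setIntegral_congr_fun measurableSet_Ioi fun u hu =>
    (orbit_add _ ht (le_of_lt hu) x).symm

section Generator

variable {B : X →ₗ.[ℂ] X} (hB : T.generator = -B)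

include hB

theorem IsContractive.resolvent_mem_graph (hs : 0 < s) (x : X) :
    (hT.resolvent s x, x - s • hT.resolvent s x) ∈ B.graph := by
  rw [← mem_graph_addScalar_iff, mem_graph_iff_hasDerivWithinAt (generator_rescale s hB)]
  have h_deriv := ((continuous_orbit (T.rescale s) x).integral_hasStrictDerivAt 0 0
    |>.hasDerivAt).const_sub (hT.resolvent s x)
  rw [orbit_zero] at h_deriv
  exact h_deriv.hasDerivWithinAt.congr (fun t ht => hT.orbit_rescale_resolvent hs x ht)
    (hT.orbit_rescale_resolvent hs x le_rfl)

theorem IsContractive.resolvent_smul_add (hs : 0 < s) {x z : X} (h : (x, z) ∈ B.graph) :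
    hT.resolvent s (s • x + z) = x := by
  have h_deriv := (mem_graph_iff_hasDerivWithinAt hB).1 h
  have h_map := ((hT.resolvent s).restrictScalars ℝ).hasFDerivAt.comp_hasDerivWithinAt 0 h_deriv
  have h_mem : (hT.resolvent s x, hT.resolvent s z) ∈ B.graph := by
    rw [mem_graph_iff_hasDerivWithinAt hB, ← map_neg]
    refine h_map.congr (fun t _ => hT.op_resolvent hs _ x) (hT.op_resolvent hs _ x)
  have h_eq := B.mem_graph_snd_inj h_mem (hT.resolvent_mem_graph hB hs x) rfl
  rw [map_add, ContinuousLinearMap.map_smul_of_tower, h_eq, add_sub_cancel]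

theorem IsContractive.resolvent_eq_sub_of_mem_graph (hs : 0 < s) {x z : X} (h : (x, z) ∈ B.graph) :
    hT.resolvent s z = x - s • hT.resolvent s x := by
  have h_res := hT.resolvent_smul_add hB hs h
  rwa [map_add, ContinuousLinearMap.map_smul_of_tower, ← eq_sub_iff_add_eq'] at h_res

theorem IsContractive.invAdd_eq_resolvent (hs : 0 < s) (x : X) :
    B.invAdd s x = hT.resolvent s x := by
  have h_left (z : (B.addScalar s).domain) : hT.resolvent s (B.addScalar s z) = z := by
    have h := hT.resolvent_smul_add hB hs (mem_graph_addScalar_iff.1 ((B.addScalar s).mem_graph z))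
    rwa [add_sub_cancel] at h
  have h_inj : Function.Injective fun z : (B.addScalar s).domain => B.addScalar s z :=
    fun z w hzw => Subtype.ext ((h_left z).symm.trans ((congrArg _ hzw).trans (h_left w)))
  have h_graph : (hT.resolvent s x, x) ∈ (B.addScalar s).graph :=
    mem_graph_addScalar_iff.2 (hT.resolvent_mem_graph hB hs x)
  obtain ⟨z, h_fst, h_snd⟩ := (B.addScalar s).mem_graph_iff.1 h_graph
  dsimp only at h_fst h_snd
  rw [← h_fst, ← h_snd]
  exact congrArg Subtype.val (Function.leftInverse_invFun h_inj z)

end Generator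

theorem IsContractive.resolvent_sub_resolvent (hs : 0 < s) (hr : 0 < r) :
    hT.resolvent s - hT.resolvent r = (r - s) • (hT.resolvent s).comp (hT.resolvent r) := by
  have h_gen : T.generator = - -T.generator := (neg_neg _).symm
  ext x
  have h := hT.resolvent_eq_sub_of_mem_graph h_gen hs (hT.resolvent_mem_graph h_gen hr x)
  rw [map_sub, ContinuousLinearMap.map_smul_of_tower, sub_eq_iff_eq_add] at h
  simp only [sub_apply, smul_apply, ContinuousLinearMap.comp_apply, h]
  module

theorem IsContractive.continuousOn_resolvent : ContinuousOn hT.resolvent (Ioi 0) := by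
  intro r hr
  have h_bound : ∀ᶠ s in 𝓝 r,
      ‖hT.resolvent s - hT.resolvent r‖ ≤ |r - s| * ((r / 2)⁻¹ * r⁻¹) := by
    filter_upwards [lt_mem_nhds (half_lt_self hr)] with s hs
    have hs' : 0 < s := (half_pos hr).trans hs
    rw [hT.resolvent_sub_resolvent hs' hr, norm_smul, Real.norm_eq_abs]
    refine mul_le_mul_of_nonneg_left ?_ (abs_nonneg _)
    refine (ContinuousLinearMap.opNorm_comp_le _ _).trans ?_
    exact mul_le_mul ((hT.norm_resolvent_le hs').trans (inv_anti₀ (half_pos hr) hs.le))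
      (hT.norm_resolvent_le hr) (norm_nonneg _) (inv_pos.2 (half_pos hr)).le
  have h_lim : Tendsto (fun s : ℝ => |r - s| * ((r / 2)⁻¹ * r⁻¹)) (𝓝 r) (𝓝 0) := by
    have h_cont : Continuous fun s : ℝ => |r - s| * ((r / 2)⁻¹ * r⁻¹) := by fun_prop
    simpa using h_cont.tendsto r
  exact ContinuousAt.continuousWithinAt
    (tendsto_sub_nhds_zero_iff.1 (squeeze_zero_norm' h_bound h_lim))

end Resolvent

section NegSqrt

variable {X : Type*} [NormedAddCommGroup X] [NormedSpace ℂ X] {T : C0Semigroup X}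
  (hT : T.IsContractive) {s ε : ℝ}

/-- The truncated Balakrishnan integral `(1/π) ∫_ε^∞ s^{-1/2} (s + B)⁻¹ ds`, where `-B` generates
`T`. It converges in the operator norm for `ε > 0`, and `B^{-1/2}` is its strong limit as
`ε → 0+`. -/
noncomputable def IsContractive.negSqrtTrunc (ε : ℝ) : X →L[ℂ] X :=
  Real.pi⁻¹ • ∫ s in Ioi ε, s ^ (-(1 / 2) : ℝ) • hT.resolvent s

include hT

theorem IsContractive.norm_rpow_smul_resolvent_le (hs : 0 < s) :
    ‖s ^ (-(1 / 2) : ℝ) • hT.resolvent s‖ ≤ s ^ (-(3 / 2) : ℝ) := by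
  have h_rpow : s ^ (-(3 / 2) : ℝ) = s ^ (-(1 / 2) : ℝ) * s⁻¹ := by
    rw [← Real.rpow_neg_one, ← Real.rpow_add hs]
    norm_num
  rw [norm_smul, Real.norm_of_nonneg (Real.rpow_nonneg hs.le _), h_rpow]
  exact mul_le_mul_of_nonneg_left (hT.norm_resolvent_le hs) (Real.rpow_nonneg hs.le _)

variable [CompleteSpace X]

theorem IsContractive.continuousOn_rpow_smul_resolvent :
    ContinuousOn (fun s : ℝ => s ^ (-(1 / 2) : ℝ) • hT.resolvent s) (Ioi 0) :=
  (continuousOn_id.rpow_const fun _ hs => .inl (ne_of_gt hs)).smul hT.continuousOn_resolvent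

theorem IsContractive.integrableOn_rpow_smul_resolvent (hε : 0 < ε) :
    IntegrableOn (fun s : ℝ => s ^ (-(1 / 2) : ℝ) • hT.resolvent s) (Ioi ε) :=
  (integrableOn_Ioi_rpow_of_lt (a := -(3 / 2)) (by norm_num) hε).mono'
    ((hT.continuousOn_rpow_smul_resolvent.mono (Ioi_subset_Ioi hε.le)).aestronglyMeasurable
      measurableSet_Ioi)
    ((ae_restrict_mem measurableSet_Ioi).mono fun _ hs =>
      hT.norm_rpow_smul_resolvent_le (hε.trans hs))

theorem IsContractive.integrableOn_rpow_smul_map_resolvent {Y : Type*} [NormedAddCommGroup Y]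
    [NormedSpace ℂ Y] (hε : 0 < ε) (L : X →L[ℂ] Y) (y : X) :
    IntegrableOn (fun s : ℝ => s ^ (-(1 / 2) : ℝ) • L (hT.resolvent s y)) (Ioi ε) := by
  refine ((hT.integrableOn_rpow_smul_resolvent hε).apply_continuousLinearMap y
    |> L.integrable_comp).congr (.of_forall fun s => ?_)
  exact L.map_smul_of_tower _ _

theorem IsContractive.map_negSqrtTrunc {Y : Type*} [NormedAddCommGroup Y] [NormedSpace ℂ Y]
    [CompleteSpace Y] (hε : 0 < ε) (L : X →L[ℂ] Y) (y : X) :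
    L (hT.negSqrtTrunc ε y) =
      Real.pi⁻¹ • ∫ s in Ioi ε, s ^ (-(1 / 2) : ℝ) • L (hT.resolvent s y) := by
  have h_int := hT.integrableOn_rpow_smul_resolvent hε
  rw [negSqrtTrunc, smul_apply, L.map_smul_of_tower, ContinuousLinearMap.integral_apply h_int,
    ← L.integral_comp_comm (h_int.apply_continuousLinearMap y)]
  simp only [smul_apply, L.map_smul_of_tower]

theorem IsContractive.negSqrtTrunc_apply (hε : 0 < ε) (y : X) :
    hT.negSqrtTrunc ε y = Real.pi⁻¹ • ∫ s in Ioi ε, s ^ (-(1 / 2) : ℝ) • hT.resolvent s y :=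
  hT.map_negSqrtTrunc hε (.id ℂ X) y

theorem IsContractive.op_negSqrtTrunc (hε : 0 < ε) (t : ℝ≥0) (y : X) :
    T.op t (hT.negSqrtTrunc ε y) = hT.negSqrtTrunc ε (T.op t y) := by
  rw [hT.map_negSqrtTrunc hε, hT.negSqrtTrunc_apply hε]
  refine congrArg _ (setIntegral_congr_fun measurableSet_Ioi fun s hs => ?_)
  exact congrArg _ (hT.op_resolvent (hε.trans hs) t y)

theorem IsContractive.norm_map_negSqrtTrunc_sub_le (hε : 0 < ε) (hε' : ε ≤ 1) (L : X →L[ℂ] X)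
    (y : X) {K : ℝ} (hK : ∀ s ∈ Ioc 0 1, ‖L (hT.resolvent s y)‖ ≤ K) :
    ‖L (hT.negSqrtTrunc ε y - hT.negSqrtTrunc 1 y)‖ ≤ 2 * Real.pi⁻¹ * K := by
  have h_bound : ‖∫ s in ε..1, s ^ (-(1 / 2) : ℝ) • L (hT.resolvent s y)‖ ≤ 2 * K := by
    refine (intervalIntegral.norm_integral_le_of_norm_le (g := fun s => s ^ (-(1 / 2) : ℝ) * K) hε'
      (.of_forall fun s hs => ?_)
      ((intervalIntegral.intervalIntegrable_rpow' (by norm_num)).mul_const K)).trans ?_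
    · have hs' : 0 < s := hε.trans hs.1
      rw [norm_smul, Real.norm_of_nonneg (Real.rpow_nonneg hs'.le _)]
      exact mul_le_mul_of_nonneg_left (hK s ⟨hs', hs.2⟩) (Real.rpow_nonneg hs'.le _)
    · rw [intervalIntegral.integral_mul_const, integral_rpow (.inl (by norm_num)), Real.one_rpow]
      refine mul_le_mul_of_nonneg_right ?_ ((norm_nonneg _).trans (hK 1 ⟨one_pos, le_rfl⟩))
      rw [div_le_iff₀ (by norm_num)]
      linarith [Real.rpow_nonneg hε.le (-(1 / 2) + 1 : ℝ)]
  rw [map_sub, hT.map_negSqrtTrunc hε, hT.map_negSqrtTrunc one_pos, ← smul_sub,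
    ← intervalIntegral.integral_interval_add_Ioi (hT.integrableOn_rpow_smul_map_resolvent hε L y)
      (hT.integrableOn_rpow_smul_map_resolvent one_pos L y), add_sub_cancel_right, norm_smul,
    Real.norm_of_nonneg (inv_nonneg.2 Real.pi_pos.le), mul_comm 2, mul_assoc]
  exact mul_le_mul_of_nonneg_left h_bound (inv_nonneg.2 Real.pi_pos.le)

section Generator

variable {B : X →ₗ.[ℂ] X} (hB : T.generator = -B)

include hB

theorem IsContractive.hasNegSqrt_iff {y z : X} :
    B.HasNegSqrt y z ↔ Tendsto (fun ε => hT.negSqrtTrunc ε y) (𝓝[>] 0) (𝓝 z) := by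
  refine tendsto_congr' ?_
  filter_upwards [self_mem_nhdsWithin] with ε hε
  rw [hT.negSqrtTrunc_apply hε]
  refine congrArg _ (setIntegral_congr_fun measurableSet_Ioi fun s hs => ?_)
  exact congrArg _ (hT.invAdd_eq_resolvent hB (lt_trans hε hs) y)

theorem IsContractive.exists_hasNegSqrt_snd_of_mem_graph {x z : X} (h : (x, z) ∈ B.graph) :
    ∃ w, B.HasNegSqrt z w := by
  have h_Ioc : IntegrableOn (fun s : ℝ => s ^ (-(1 / 2) : ℝ) • hT.resolvent s z) (Ioc 0 1) := by
    refine Integrable.mono' (g := fun s => s ^ (-(1 / 2) : ℝ) * (2 * ‖x‖))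
      (((intervalIntegral.intervalIntegrable_rpow' (by norm_num)).1).mul_const _)
      (((hT.continuousOn_rpow_smul_resolvent.clm_apply continuousOn_const).mono
        Ioc_subset_Ioi_self).aestronglyMeasurable measurableSet_Ioc) ?_
    filter_upwards [ae_restrict_mem measurableSet_Ioc] with s hs
    rw [norm_smul, Real.norm_of_nonneg (Real.rpow_nonneg hs.1.le _),
      hT.resolvent_eq_sub_of_mem_graph hB hs.1 h]
    exact mul_le_mul_of_nonneg_left (hT.norm_sub_smul_resolvent_le hs.1 x)
      (Real.rpow_nonneg hs.1.le _)
  have h_int : IntegrableOn (fun s : ℝ => s ^ (-(1 / 2) : ℝ) • hT.resolvent s z) (Ioi 0) := by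
    rw [← Ioc_union_Ioi_eq_Ioi zero_le_one]
    exact h_Ioc.union (hT.integrableOn_rpow_smul_map_resolvent one_pos (.id ℂ X) z)
  refine ⟨_, (hT.hasNegSqrt_iff hB).2 (((aecover_Ioi_of_Ioi (tendsto_id'.2
    nhdsWithin_le_nhds)).integral_tendsto_of_countably_generated h_int |>.const_smul
      Real.pi⁻¹).congr' ?_)⟩
  filter_upwards [self_mem_nhdsWithin] with ε hε
  rw [hT.negSqrtTrunc_apply hε, Measure.restrict_restrict measurableSet_Ioi,
    inter_eq_left.2 (Ioi_subset_Ioi (le_of_lt hε)), id]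

theorem IsContractive.exists_continuousLinearMap_hasNegSqrt
    (h : ∀ x ∈ B.domain, ∃ w, B.HasNegSqrt x w) : ∃ P : X →L[ℂ] X, ∀ y, B.HasNegSqrt y (P y) := by
  have h_all (y : X) : ∃ w, B.HasNegSqrt y w := by
    have h_graph := hT.resolvent_mem_graph hB one_pos y
    obtain ⟨u, hu⟩ := h _ (B.mem_domain_of_mem_graph h_graph)
    obtain ⟨w, hw⟩ := hT.exists_hasNegSqrt_snd_of_mem_graph hB h_graph
    rw [hT.hasNegSqrt_iff hB] at hu hw
    refine ⟨u + w, (hT.hasNegSqrt_iff hB).2 ((hu.add hw).congr fun ε => ?_)⟩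
    rw [← map_add, one_smul, add_sub_cancel]
  choose P hP using h_all
  simp only [hT.hasNegSqrt_iff hB] at hP ⊢
  exact ⟨continuousLinearMapOfTendsto _ (tendsto_pi_nhds.2 hP), hP⟩

end Generator

end NegSqrt

section SquareFunction

theorem lintegral_rpow_neg_half_mul_exp_le {ε u : ℝ} (hε : 0 ≤ ε) (hu : 0 < u) :
    ∫⁻ s in Ioi ε, ENNReal.ofReal (s ^ (-(1 / 2) : ℝ)) * ENNReal.ofReal (Real.exp (-(s - ε) * u)) ≤
      ENNReal.ofReal (√Real.pi) * invSqrtKernel u := by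
  set g : ℝ → ℝ := fun s => s ^ ((1 / 2 : ℝ) - 1) * Real.exp (-(u * s)) with hg
  have hg_int : IntegrableOn g (Ioi 0) := by
    simpa only [Real.rpow_one, neg_mul] using
      integrableOn_rpow_mul_exp_neg_mul_rpow (s := 1 / 2 - 1) (by norm_num) one_pos hu
  have hg_nonneg : ∀ᵐ s ∂volume.restrict (Ioi 0), 0 ≤ g s := by
    filter_upwards [ae_restrict_mem measurableSet_Ioi] with s hs
    exact mul_nonneg (Real.rpow_nonneg (le_of_lt hs) _) (Real.exp_nonneg _)
  have hg_gamma : ∫ s in Ioi 0, g s = u ^ (-(1 / 2) : ℝ) * √Real.pi := by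
    rw [hg, Real.integral_rpow_mul_exp_neg_mul_Ioi (by norm_num) hu, Real.Gamma_one_half_eq,
      one_div u, Real.inv_rpow hu.le, Real.rpow_neg hu.le]
  have h_le (s : ℝ) (hs : s ∈ Ioi 0) : ENNReal.ofReal ((s + ε) ^ (-(1 / 2) : ℝ)) *
      ENNReal.ofReal (Real.exp (-(s + ε - ε) * u)) ≤ ENNReal.ofReal (g s) := by
    have hs' : 0 < s := hs
    rw [← ENNReal.ofReal_mul (Real.rpow_nonneg (add_nonneg hs'.le hε) _), hg, add_sub_cancel_right,
      neg_mul, mul_comm s u, show (1 / 2 : ℝ) - 1 = -(1 / 2) by norm_num]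
    exact ENNReal.ofReal_le_ofReal (mul_le_mul_of_nonneg_right
      (Real.rpow_le_rpow_of_nonpos hs' (le_add_of_nonneg_right hε) (by norm_num))
      (Real.exp_nonneg _))
  rw [← lintegral_Ioi_comp_add_right]
  refine (setLIntegral_mono' measurableSet_Ioi h_le).trans_eq ?_
  rw [← ofReal_integral_eq_lintegral_ofReal hg_int hg_nonneg, hg_gamma, mul_comm,
    ENNReal.ofReal_mul (Real.sqrt_nonneg _), invSqrtKernel_of_pos hu]

section Banach

variable {X Y : Type*} [NormedAddCommGroup X] [NormedSpace ℂ X] [NormedAddCommGroup Y]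
  [NormedSpace ℂ Y] {T : C0Semigroup X} (hT : T.IsContractive) {ε s : ℝ}

include hT

theorem IsContractive.lintegral_rpow_mul_sq_enorm_orbit_rescale_ne_top (hε : 0 < ε) {p : ℝ}
    (hp : -1 < p) (x : X) :
    ∫⁻ t in Ioi 0, ENNReal.ofReal (t ^ p) * ‖(T.rescale ε).orbit x t‖ₑ ^ 2 ≠ ∞ := by
  have h_int := (integrableOn_rpow_mul_exp_neg_mul_rpow hp one_pos
    (mul_pos two_pos hε)).mul_const (‖x‖ ^ 2)
  refine ne_top_of_le_ne_top h_int.lintegral_lt_top.ne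
    (setLIntegral_mono' measurableSet_Ioi fun t ht => ?_)
  have h_norm : ‖(T.rescale ε).orbit x t‖ ^ 2 ≤ Real.exp (-(2 * ε) * t ^ (1 : ℝ)) * ‖x‖ ^ 2 := by
    refine (pow_le_pow_left₀ (norm_nonneg _)
      (hT.norm_orbit_rescale_le ε x (le_of_lt ht)) 2).trans_eq ?_
    rw [mul_pow, ← Real.exp_nat_mul, Real.rpow_one]
    ring_nf
  rw [← ofReal_norm, ← ENNReal.ofReal_pow (norm_nonneg _),
    ← ENNReal.ofReal_mul (Real.rpow_nonneg (le_of_lt ht) p), mul_assoc]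
  exact ENNReal.ofReal_le_ofReal (mul_le_mul_of_nonneg_left h_norm
    (Real.rpow_nonneg (le_of_lt ht) p))

variable [CompleteSpace X] [CompleteSpace Y]

theorem IsContractive.enorm_map_resolvent_le (hs : 0 < s) (ε : ℝ) (L : X →L[ℂ] Y) (y : X) :
    ‖L (hT.resolvent s y)‖ₑ ≤ ∫⁻ u in Ioi 0,
      ENNReal.ofReal (Real.exp (-(s - ε) * u)) * ‖L ((T.rescale ε).orbit y u)‖ₑ := by
  rw [hT.map_resolvent hs]
  refine (enorm_integral_le_lintegral_enorm _).trans_eq ?_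
  refine setLIntegral_congr_fun measurableSet_Ioi fun u hu => ?_
  have h_exp : Real.exp (-s * u) = Real.exp (-(s - ε) * u) * Real.exp (-ε * u) := by
    rw [← Real.exp_add]
    ring_nf
  rw [T.orbit_rescale s y (le_of_lt hu), T.orbit_rescale ε y (le_of_lt hu), h_exp, mul_smul,
    L.map_smul_of_tower, enorm_smul, Real.enorm_of_nonneg (Real.exp_nonneg _)]

theorem IsContractive.enorm_integral_rpow_smul_map_resolvent_le (hε : 0 < ε) (L : X →L[ℂ] Y)
    (y : X) :
    ‖∫ s in Ioi ε, s ^ (-(1 / 2) : ℝ) • L (hT.resolvent s y)‖ₑ ≤ ENNReal.ofReal (√Real.pi) *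
      ∫⁻ u, invSqrtKernel u * ‖L ((T.rescale ε).orbit y u)‖ₑ := by
  set H : ℝ → ℝ≥0∞ := fun u => ‖L ((T.rescale ε).orbit y u)‖ₑ
  have hH_meas : Measurable H := (L.continuous.comp (continuous_orbit _ y)).enorm.measurable
  have h_kernel_meas := measurable_invSqrtKernel
  calc ‖∫ s in Ioi ε, s ^ (-(1 / 2) : ℝ) • L (hT.resolvent s y)‖ₑ
      ≤ ∫⁻ s in Ioi ε, ∫⁻ u in Ioi 0,
          ENNReal.ofReal (s ^ (-(1 / 2) : ℝ)) * ENNReal.ofReal (Real.exp (-(s - ε) * u)) * H u := by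
        refine (enorm_integral_le_lintegral_enorm _).trans
          (setLIntegral_mono' measurableSet_Ioi fun s hs => ?_)
        have hs' : 0 < s := hε.trans hs
        simp only [mul_assoc]
        rw [enorm_smul, Real.enorm_of_nonneg (Real.rpow_nonneg hs'.le _),
          lintegral_const_mul _ (by fun_prop)]
        gcongr
        exact hT.enorm_map_resolvent_le hs' ε L y
    _ = ∫⁻ u in Ioi 0, (∫⁻ s in Ioi ε,
          ENNReal.ofReal (s ^ (-(1 / 2) : ℝ)) * ENNReal.ofReal (Real.exp (-(s - ε) * u))) *
            H u := by
        rw [lintegral_lintegral_swap (by unfold Function.uncurry; fun_prop)]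
        exact lintegral_congr fun u => lintegral_mul_const _ (by fun_prop)
    _ ≤ ∫⁻ u in Ioi 0, ENNReal.ofReal (√Real.pi) * (invSqrtKernel u * H u) := by
        refine setLIntegral_mono' measurableSet_Ioi fun u hu => ?_
        rw [← mul_assoc]
        gcongr
        exact lintegral_rpow_neg_half_mul_exp_le hε.le hu
    _ ≤ ENNReal.ofReal (√Real.pi) * ∫⁻ u, invSqrtKernel u * H u := by
        rw [lintegral_const_mul _ (by fun_prop)]
        gcongr
        exact Measure.restrict_le_self

theorem IsContractive.enorm_map_negSqrtTrunc_le (hε : 0 < ε) (L : X →L[ℂ] Y) (y : X) :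
    ‖L (hT.negSqrtTrunc ε y)‖ₑ ≤ ENNReal.ofReal (√Real.pi)⁻¹ *
      ∫⁻ u, invSqrtKernel u * ‖L ((T.rescale ε).orbit y u)‖ₑ := by
  have h_pi : Real.pi⁻¹ * √Real.pi = (√Real.pi)⁻¹ := by
    nth_rw 1 [← Real.mul_self_sqrt Real.pi_pos.le]
    field_simp
  rw [hT.map_negSqrtTrunc hε, enorm_smul, Real.enorm_of_nonneg (inv_pos.2 Real.pi_pos).le, ← h_pi,
    ENNReal.ofReal_mul (inv_pos.2 Real.pi_pos).le, mul_assoc]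
  gcongr
  exact hT.enorm_integral_rpow_smul_map_resolvent_le hε L y

end Banach

section Hilbert

variable {X : Type*} [NormedAddCommGroup X] [InnerProductSpace ℂ X] [CompleteSpace X]
  {T : C0Semigroup X} (hT : T.IsContractive)

include hT

theorem IsContractive.exists_sq_enorm_map_orbit_add_eq {τ : ℝ} (hτ : 0 ≤ τ) :
    ∃ D : X →L[ℂ] X, ∀ x, ∀ t ∈ Ioi 0,
      ‖D (T.orbit x t)‖ₑ ^ 2 + ‖T.orbit x (t + τ)‖ₑ ^ 2 = ‖T.orbit x t‖ₑ ^ 2 := by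
  obtain ⟨D, hD⟩ := exists_norm_sq_add_norm_sq_eq (hT τ.toNNReal)
  refine ⟨D, fun x t ht => ?_⟩
  rw [add_comm t, T.orbit_add hτ (le_of_lt ht)]
  simp only [← ofReal_norm, ← ENNReal.ofReal_pow (norm_nonneg _)]
  rw [← ENNReal.ofReal_add (by positivity) (by positivity), hD]

theorem IsContractive.ofReal_mul_sq_enorm_orbit_le {x y : X} {c : ℝ≥0∞} (hc : c ≠ ∞)
    (hx : ∫⁻ t in Ioi 0, ‖T.orbit x t‖ₑ ^ 2 ≠ ∞)
    (hy : ∫⁻ t in Ioi 0, ENNReal.ofReal t * ‖T.orbit y t‖ₑ ^ 2 ≠ ∞)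
    (hxy : ∀ L : X →L[ℂ] X, ‖L x‖ₑ ≤ c * ∫⁻ u, invSqrtKernel u * ‖L (T.orbit y u)‖ₑ)
    {τ : ℝ} (hτ : 0 ≤ τ) :
    ENNReal.ofReal τ * ‖T.orbit x τ‖ₑ ^ 2 ≤
      ENNReal.ofReal τ * (16 * c ^ 2 * ∫⁻ t in Ioi 0, ‖T.orbit y t‖ₑ ^ 2) := by
  obtain ⟨D, hD⟩ := hT.exists_sq_enorm_map_orbit_add_eq hτ
  have hD_meas (z : X) : Measurable fun t => ‖D (T.orbit z t)‖ₑ :=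
    (D.continuous.comp (T.continuous_orbit z)).enorm.measurable
  have hDx (t : ℝ) (ht : t ∈ Ioi 0) : ‖D (T.orbit x t)‖ₑ ≤
      c * ∫⁻ u, invSqrtKernel u * ‖D (T.orbit y (t + u))‖ₑ := by
    refine (hxy (D.comp (T.op t.toNNReal))).trans_eq (congrArg _ (lintegral_congr fun u => ?_))
    rcases le_or_gt u 0 with hu | hu
    · rw [invSqrtKernel_of_nonpos hu, zero_mul, zero_mul]
    · rw [T.orbit_add (le_of_lt ht) hu.le, ContinuousLinearMap.comp_apply]
  calc ENNReal.ofReal τ * ‖T.orbit x τ‖ₑ ^ 2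
      = ∫⁻ _ in Ioc 0 τ, ‖T.orbit x τ‖ₑ ^ 2 := by
        rw [setLIntegral_const, Real.volume_Ioc, sub_zero, mul_comm]
    _ ≤ ∫⁻ t in Ioc 0 τ, ‖T.orbit x t‖ₑ ^ 2 := by
        refine setLIntegral_mono' measurableSet_Ioc fun t ht => pow_le_pow_left₀ zero_le ?_ 2
        exact enorm_le_iff_norm_le.2 (hT.antitone_norm_orbit x ht.1.le hτ ht.2)
    _ = ∫⁻ t in Ioi 0, ‖D (T.orbit x t)‖ₑ ^ 2 :=
        (lintegral_increment_eq ((hD_meas x).pow_const 2) hτ (hD x) hx).symm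
    _ ≤ ∫⁻ t in Ioi 0, c ^ 2 * (∫⁻ u, invSqrtKernel u * ‖D (T.orbit y (t + u))‖ₑ) ^ 2 := by
        refine setLIntegral_mono' measurableSet_Ioi fun t ht => ?_
        rw [← mul_pow]
        exact pow_le_pow_left₀ zero_le (hDx t ht) 2
    _ ≤ c ^ 2 * (16 * ∫⁻ t in Ioi 0, ENNReal.ofReal t * ‖D (T.orbit y t)‖ₑ ^ 2) := by
        rw [lintegral_const_mul' _ _ (ENNReal.pow_ne_top hc)]
        gcongr
        exact lintegral_sq_lintegral_invSqrtKernel_mul_le (hD_meas y)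
    _ ≤ c ^ 2 * (16 * (ENNReal.ofReal τ * ∫⁻ t in Ioi 0, ‖T.orbit y t‖ₑ ^ 2)) := by
        gcongr
        exact lintegral_mul_increment_le ((T.continuous_orbit y).enorm.measurable.pow_const 2)
          ((hD_meas y).pow_const 2) hτ (hD y) hy
    _ = ENNReal.ofReal τ * (16 * c ^ 2 * ∫⁻ t in Ioi 0, ‖T.orbit y t‖ₑ ^ 2) := by ring

theorem IsContractive.sq_enorm_le_lintegral_sq_enorm_orbit {x y : X} {c : ℝ≥0∞} (hc : c ≠ ∞)
    (hx : ∫⁻ t in Ioi 0, ‖T.orbit x t‖ₑ ^ 2 ≠ ∞)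
    (hy : ∫⁻ t in Ioi 0, ENNReal.ofReal t * ‖T.orbit y t‖ₑ ^ 2 ≠ ∞)
    (hxy : ∀ L : X →L[ℂ] X, ‖L x‖ₑ ≤ c * ∫⁻ u, invSqrtKernel u * ‖L (T.orbit y u)‖ₑ) :
    ‖x‖ₑ ^ 2 ≤ 16 * c ^ 2 * ∫⁻ t in Ioi 0, ‖T.orbit y t‖ₑ ^ 2 := by
  have h_lim := (((ENNReal.continuous_pow 2).comp (T.continuous_orbit x).enorm).tendsto 0).mono_left
    (nhdsWithin_le_nhds (s := Ioi 0))
  simp only [Function.comp_apply, T.orbit_zero] at h_lim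
  refine le_of_tendsto h_lim ?_
  filter_upwards [self_mem_nhdsWithin] with τ hτ
  have h_mul := hT.ofReal_mul_sq_enorm_orbit_le hc hx hy hxy (le_of_lt hτ)
  rwa [ENNReal.mul_le_mul_iff_right (ENNReal.ofReal_pos.2 hτ).ne' ENNReal.ofReal_ne_top] at h_mul

theorem IsContractive.sq_enorm_negSqrtTrunc_le {ε : ℝ} (hε : 0 < ε) (y : X) :
    ‖hT.negSqrtTrunc ε y‖ₑ ^ 2 ≤
      16 * ENNReal.ofReal Real.pi⁻¹ * ∫⁻ t in Ioi 0, ‖(T.rescale ε).orbit y t‖ₑ ^ 2 := by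
  have h_fin {p : ℝ} (hp : -1 < p) (x : X) :=
    hT.lintegral_rpow_mul_sq_enorm_orbit_rescale_ne_top hε hp x
  have h_sq : ENNReal.ofReal (√Real.pi)⁻¹ ^ 2 = ENNReal.ofReal Real.pi⁻¹ := by
    rw [← ENNReal.ofReal_pow (inv_nonneg.2 (Real.sqrt_nonneg _)), inv_pow,
      Real.sq_sqrt Real.pi_pos.le]
  have h_le := (hT.rescale hε.le).sq_enorm_le_lintegral_sq_enorm_orbit ENNReal.ofReal_ne_top
    (by simpa only [Real.rpow_zero, ENNReal.ofReal_one, one_mul] using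
      h_fin (p := 0) (by norm_num) (hT.negSqrtTrunc ε y))
    (by simpa only [Real.rpow_one] using h_fin (p := 1) (by norm_num) y)
    fun L => hT.enorm_map_negSqrtTrunc_le hε L y
  rwa [h_sq] at h_le

end Hilbert

end SquareFunction

section Observability

theorem sq_integral_le_mul_integral_sq {f : ℝ → ℝ} (hf : Continuous f) {a b : ℝ} (hab : a ≤ b) :
    (∫ t in a..b, f t) ^ 2 ≤ (b - a) * ∫ t in a..b, f t ^ 2 := by
  rcases hab.eq_or_lt with rfl | hab
  · simp
  set c := ∫ t in a..b, f t
  set d := b - a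
  have h_int {g : ℝ → ℝ} (hg : Continuous g) : IntervalIntegrable g volume a b :=
    hg.intervalIntegrable a b
  have h_nonneg : 0 ≤ ∫ t in a..b, (d * f t - c) ^ 2 :=
    intervalIntegral.integral_nonneg hab.le fun t _ => sq_nonneg _
  have h_eq : ∫ t in a..b, (d * f t - c) ^ 2 = d * (d * (∫ t in a..b, f t ^ 2) - c ^ 2) := by
    have h_expand (t : ℝ) : (d * f t - c) ^ 2 = d ^ 2 * f t ^ 2 - 2 * d * c * f t + c ^ 2 := by
      ring
    simp only [h_expand]
    rw [intervalIntegral.integral_add (h_int (by fun_prop)) (h_int (by fun_prop)),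
      intervalIntegral.integral_sub (h_int (by fun_prop)) (h_int (by fun_prop)),
      intervalIntegral.integral_const_mul, intervalIntegral.integral_const_mul,
      intervalIntegral.integral_const, smul_eq_mul]
    ring
  rw [h_eq] at h_nonneg
  exact sub_nonneg.1 ((mul_nonneg_iff_of_pos_left (sub_pos.2 hab)).1 h_nonneg)

theorem add_add_sq_le_three_mul (a b c : ℝ) :
    (a + b + c) ^ 2 ≤ 3 * (a ^ 2 + b ^ 2 + c ^ 2) := by
  nlinarith [sq_nonneg (a - b), sq_nonneg (a - c), sq_nonneg (b - c)]

section Banach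

variable {X : Type*} [NormedAddCommGroup X] [NormedSpace ℂ X] {T : C0Semigroup X}
  (hT : T.IsContractive) {η : ℝ}

include hT

theorem IsContractive.mul_sq_norm_orbit_le_integral (hη : 0 ≤ η) (y : X) :
    η * ‖T.orbit y η‖ ^ 2 ≤ ∫ t in (0 : ℝ)..η, ‖T.orbit y t‖ ^ 2 := by
  have h_mono := intervalIntegral.integral_mono_on (f := fun _ => ‖T.orbit y η‖ ^ 2) hη
    intervalIntegrable_const
    (((T.continuous_orbit y).norm.pow 2).intervalIntegrable (μ := volume) 0 η)
    fun t ht => pow_le_pow_left₀ (norm_nonneg _) (hT.antitone_norm_orbit y ht.1 hη ht.2) 2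
  rwa [intervalIntegral.integral_const, sub_zero, smul_eq_mul] at h_mono

theorem IsContractive.sq_norm_orbit_map_le (hη : 0 < η) {W : X →L[ℂ] X}
    (hW : ∀ y, T.op η.toNNReal (W y) = W (T.op η.toNNReal y)) (y : X) :
    ‖T.orbit (W y) η‖ ^ 2 ≤ ‖W‖ ^ 2 * η⁻¹ * ∫ t in (0 : ℝ)..η, ‖T.orbit y t‖ ^ 2 := by
  calc ‖T.orbit (W y) η‖ ^ 2
      ≤ (‖W‖ * ‖T.orbit y η‖) ^ 2 := by
        rw [orbit, hW]
        gcongr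
        exact W.le_opNorm _
    _ = ‖W‖ ^ 2 * η⁻¹ * (η * ‖T.orbit y η‖ ^ 2) := by field_simp
    _ ≤ ‖W‖ ^ 2 * η⁻¹ * ∫ t in (0 : ℝ)..η, ‖T.orbit y t‖ ^ 2 := by
        gcongr
        exact hT.mul_sq_norm_orbit_le_integral hη.le y

theorem IsContractive.lintegral_Ioi_sq_enorm_orbit_rescale_le {ε : ℝ} (hε : 0 < ε) (hη : 0 < η)
    (y : X) :
    ∫⁻ t in Ioi η, ‖(T.rescale ε).orbit y t‖ₑ ^ 2 ≤
      ENNReal.ofReal ((2 * ε * η)⁻¹ * ∫ t in (0 : ℝ)..η, ‖T.orbit y t‖ ^ 2) := by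
  have h_le (t : ℝ) (ht : t ∈ Ioi η) : ‖(T.rescale ε).orbit y t‖ₑ ^ 2 ≤
      ENNReal.ofReal (Real.exp (-(2 * ε) * t) * ‖T.orbit y η‖ ^ 2) := by
    have ht0 : 0 ≤ t := hη.le.trans (le_of_lt ht)
    rw [← ofReal_norm, ← ENNReal.ofReal_pow (norm_nonneg _), T.orbit_rescale ε y ht0, norm_smul,
      mul_pow, Real.norm_of_nonneg (Real.exp_nonneg _), ← Real.exp_nat_mul]
    have h_anti := hT.antitone_norm_orbit y hη.le ht0 (le_of_lt ht)
    refine ENNReal.ofReal_le_ofReal (mul_le_mul (Real.exp_le_exp.2 (le_of_eq ?_))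
      (pow_le_pow_left₀ (norm_nonneg _) h_anti 2) (by positivity) (by positivity))
    push_cast
    ring
  have h_int : IntegrableOn (fun t => Real.exp (-(2 * ε) * t)) (Ioi η) :=
    exp_neg_integrableOn_Ioi η (by positivity)
  refine (setLIntegral_mono' measurableSet_Ioi h_le).trans ?_
  rw [← ofReal_integral_eq_lintegral_ofReal (h_int.mul_const _)
    (.of_forall fun t => by positivity), integral_mul_const,
    integral_exp_mul_Ioi (by linarith) η]
  refine ENNReal.ofReal_le_ofReal ?_
  have h_exp : Real.exp (-(2 * ε) * η) ≤ 1 := Real.exp_le_one_iff.2 (by nlinarith)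
  have h_sq := hT.mul_sq_norm_orbit_le_integral hη.le y
  calc -Real.exp (-(2 * ε) * η) / -(2 * ε) * ‖T.orbit y η‖ ^ 2
      = (2 * ε * η)⁻¹ * (Real.exp (-(2 * ε) * η) * (η * ‖T.orbit y η‖ ^ 2)) := by field_simp
    _ ≤ (2 * ε * η)⁻¹ * (1 * ∫ t in (0 : ℝ)..η, ‖T.orbit y t‖ ^ 2) := by gcongr
    _ = (2 * ε * η)⁻¹ * ∫ t in (0 : ℝ)..η, ‖T.orbit y t‖ ^ 2 := by rw [one_mul]

theorem IsContractive.lintegral_sq_enorm_orbit_rescale_le {ε : ℝ} (hε : 0 < ε) (hη : 0 < η)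
    (y : X) :
    ∫⁻ t in Ioi 0, ‖(T.rescale ε).orbit y t‖ₑ ^ 2 ≤
      ENNReal.ofReal ((1 + (2 * ε * η)⁻¹) * ∫ t in (0 : ℝ)..η, ‖T.orbit y t‖ ^ 2) := by
  have h_Ioc : ∫⁻ t in Ioc 0 η, ‖(T.rescale ε).orbit y t‖ₑ ^ 2 ≤
      ENNReal.ofReal (∫ t in (0 : ℝ)..η, ‖T.orbit y t‖ ^ 2) := by
    rw [intervalIntegral.integral_of_le hη.le, ofReal_integral_eq_lintegral_ofReal
      (f := fun t => ‖T.orbit y t‖ ^ 2) (by fun_prop : Continuous _).integrableOn_Ioc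
      (.of_forall fun t => by positivity)]
    refine setLIntegral_mono' measurableSet_Ioc fun t ht => ?_
    have h_exp : Real.exp (-ε * t) ≤ 1 := Real.exp_le_one_iff.2 (by nlinarith [ht.1])
    rw [← ofReal_norm, ← ENNReal.ofReal_pow (norm_nonneg _), T.orbit_rescale ε y ht.1.le,
      norm_smul, Real.norm_of_nonneg (Real.exp_nonneg _)]
    gcongr
    exact mul_le_of_le_one_left (norm_nonneg _) h_exp
  have h_nonneg : 0 ≤ ∫ t in (0 : ℝ)..η, ‖T.orbit y t‖ ^ 2 :=
    intervalIntegral.integral_nonneg hη.le fun t _ => by positivity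
  rw [← Ioc_union_Ioi_eq_Ioi hη.le, lintegral_union measurableSet_Ioi (Ioc_disjoint_Ioi le_rfl),
    add_mul, one_mul, ENNReal.ofReal_add h_nonneg (by positivity)]
  exact add_le_add h_Ioc (hT.lintegral_Ioi_sq_enorm_orbit_rescale_le hε hη y)

variable [CompleteSpace X] {B : X →ₗ.[ℂ] X} (hB : T.generator = -B)

include hB

theorem IsContractive.norm_resolvent_sub_orbit_le {s : ℝ} (hs : 0 < s) (hη : 0 ≤ η) (y : X) :
    ‖hT.resolvent s y - T.orbit (hT.resolvent s y) η‖ ≤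
      2 * ∫ t in (0 : ℝ)..η, ‖T.orbit y t‖ := by
  rw [sub_orbit_eq_integral hB (hT.resolvent_mem_graph hB hs y) hη,
    ← intervalIntegral.integral_const_mul]
  refine intervalIntegral.norm_integral_le_of_norm_le hη (.of_forall fun t _ => ?_)
    (((T.continuous_orbit y).norm.const_mul 2).intervalIntegrable _ _)
  rw [orbit, map_sub, ContinuousLinearMap.map_smul_of_tower, hT.op_resolvent hs]
  exact hT.norm_sub_smul_resolvent_le hs _

theorem IsContractive.op_negSqrt_comm {P : X → X} (hP : ∀ y, B.HasNegSqrt y (P y)) (t : ℝ≥0)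
    (y : X) : T.op t (P y) = P (T.op t y) := by
  have h_lim := ((T.op t).continuous.tendsto _).comp ((hT.hasNegSqrt_iff hB).1 (hP y))
  refine tendsto_nhds_unique (h_lim.congr' ?_) ((hT.hasNegSqrt_iff hB).1 (hP (T.op t y)))
  filter_upwards [self_mem_nhdsWithin] with ε hε
  exact hT.op_negSqrtTrunc hε t y

theorem IsContractive.norm_negSqrt_sub_orbit_le {y z : X} (hz : B.HasNegSqrt y z) (hη : 0 ≤ η) :
    ‖z - hT.negSqrtTrunc 1 y - T.orbit (z - hT.negSqrtTrunc 1 y) η‖ ≤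
      4 * Real.pi⁻¹ * ∫ t in (0 : ℝ)..η, ‖T.orbit y t‖ := by
  set L : X →L[ℂ] X := .id ℂ X - T.op η.toNNReal
  have h_lim : Tendsto (fun ε => ‖L (hT.negSqrtTrunc ε y - hT.negSqrtTrunc 1 y)‖) (𝓝[>] 0)
      (𝓝 ‖L (z - hT.negSqrtTrunc 1 y)‖) :=
    ((L.continuous.tendsto _).comp (((hT.hasNegSqrt_iff hB).1 hz).sub_const _)).norm
  refine le_of_tendsto h_lim ?_
  filter_upwards [Ioc_mem_nhdsGT zero_lt_one] with ε hε
  refine (hT.norm_map_negSqrtTrunc_sub_le hε.1 hε.2 L y fun s hs =>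
    hT.norm_resolvent_sub_orbit_le hB hs.1 hη y).trans_eq ?_
  ring

theorem IsContractive.sq_norm_negSqrt_sub_orbit_le {y z : X} (hz : B.HasNegSqrt y z)
    (hη : 0 ≤ η) :
    ‖z - hT.negSqrtTrunc 1 y - T.orbit (z - hT.negSqrtTrunc 1 y) η‖ ^ 2 ≤
      (4 * Real.pi⁻¹) ^ 2 * η * ∫ t in (0 : ℝ)..η, ‖T.orbit y t‖ ^ 2 := by
  have h_sq := sq_integral_le_mul_integral_sq (T.continuous_orbit y).norm hη
  rw [sub_zero] at h_sq
  refine (pow_le_pow_left₀ (norm_nonneg _) (hT.norm_negSqrt_sub_orbit_le hB hz hη) 2).trans ?_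
  rw [mul_pow, mul_assoc]
  gcongr

end Banach

section Hilbert

variable {X : Type*} [NormedAddCommGroup X] [InnerProductSpace ℂ X] [CompleteSpace X]
  {T : C0Semigroup X} (hT : T.IsContractive) {η : ℝ}

include hT

theorem IsContractive.sq_norm_negSqrtTrunc_one_le (hη : 0 < η) (y : X) :
    ‖hT.negSqrtTrunc 1 y‖ ^ 2 ≤
      16 * Real.pi⁻¹ * (1 + (2 * η)⁻¹) * ∫ t in (0 : ℝ)..η, ‖T.orbit y t‖ ^ 2 := by
  have h_nonneg : 0 ≤ ∫ t in (0 : ℝ)..η, ‖T.orbit y t‖ ^ 2 :=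
    intervalIntegral.integral_nonneg hη.le fun t _ => by positivity
  rw [← ENNReal.ofReal_le_ofReal_iff (by positivity), ENNReal.ofReal_pow (norm_nonneg _),
    ofReal_norm, mul_assoc (16 * _), ENNReal.ofReal_mul (by positivity),
    ENNReal.ofReal_mul (by norm_num), ENNReal.ofReal_ofNat]
  refine (hT.sq_enorm_negSqrtTrunc_le one_pos y).trans ?_
  gcongr
  simpa only [mul_one] using hT.lintegral_sq_enorm_orbit_rescale_le one_pos hη y

theorem IsContractive.exists_sq_norm_le_integral_of_hasNegSqrt {B : X →ₗ.[ℂ] X}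
    (hB : T.generator = -B) {P : X →L[ℂ] X} (hP : ∀ y, B.HasNegSqrt y (P y)) (hη : 0 < η) :
    ∃ K, 0 < K ∧ ∀ y, ‖P y‖ ^ 2 ≤ K * ∫ t in (0 : ℝ)..η, ‖T.orbit y t‖ ^ 2 := by
  set R := hT.negSqrtTrunc 1
  set W := P - R
  have hW_apply (y : X) : W y = P y - R y := rfl
  have hW_comm (y : X) : T.op η.toNNReal (W y) = W (T.op η.toNNReal y) := by
    rw [hW_apply, hW_apply, map_sub, hT.op_negSqrt_comm hB hP, hT.op_negSqrtTrunc one_pos]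
  refine ⟨3 * (16 * Real.pi⁻¹ * (1 + (2 * η)⁻¹) + (4 * Real.pi⁻¹) ^ 2 * η + ‖W‖ ^ 2 * η⁻¹),
    by positivity, fun y => ?_⟩
  have h_split : P y = R y + (W y - T.orbit (W y) η) + T.orbit (W y) η := by
    rw [add_assoc, sub_add_cancel, hW_apply, add_sub_cancel]
  have h_norm : ‖P y‖ ≤ ‖R y‖ + ‖W y - T.orbit (W y) η‖ + ‖T.orbit (W y) η‖ :=
    (congrArg norm h_split).trans_le norm_add₃_le
  calc ‖P y‖ ^ 2
      ≤ (‖R y‖ + ‖W y - T.orbit (W y) η‖ + ‖T.orbit (W y) η‖) ^ 2 := by gcongr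
    _ ≤ 3 * (‖R y‖ ^ 2 + ‖W y - T.orbit (W y) η‖ ^ 2 + ‖T.orbit (W y) η‖ ^ 2) :=
        add_add_sq_le_three_mul _ _ _
    _ ≤ _ := by
        rw [mul_assoc, add_mul, add_mul]
        gcongr
        · exact hT.sq_norm_negSqrtTrunc_one_le hη y
        · exact hT.sq_norm_negSqrt_sub_orbit_le hB (hP y) hη.le
        · exact hT.sq_norm_orbit_map_le hη hW_comm y

end Hilbert

end Observability

section DenseRange

variable {X : Type*} [NormedAddCommGroup X] [InnerProductSpace ℂ X] {T : C0Semigroup X}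
  (hT : T.IsContractive) {B : X →ₗ.[ℂ] X}

include hT

theorem IsContractive.re_inner_nonneg_of_mem_graph (hB : T.generator = -B) {x z : X}
    (h : (x, z) ∈ B.graph) : 0 ≤ (inner ℂ x z).re := by
  let _ : InnerProductSpace ℝ X := .complexToReal
  have h_deriv := HasDerivWithinAt.norm_sq (F := X) (hasDerivWithinAt_orbit hB h le_rfl)
  have h_anti : AntitoneOn (fun t => ‖T.orbit x t‖ ^ 2) (Ici 0) := fun s hs t ht hst =>
    pow_le_pow_left₀ (norm_nonneg _) (hT.antitone_norm_orbit x hs ht hst) 2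
  have h_nonpos := h_anti.derivWithin_nonpos (x := 0)
  rw [h_deriv.derivWithin (uniqueDiffWithinAt_Ici 0), orbit_zero, orbit_zero, inner_neg_right,
    real_inner_eq_re_inner ℂ, RCLike.re_to_complex] at h_nonpos
  exact nonneg_of_mul_nonneg_right (by linarith) two_pos

variable [CompleteSpace X]

theorem IsContractive.mul_sq_norm_resolvent_le {s : ℝ} (hs : 0 < s) (y : X) :
    s * ‖hT.resolvent s y‖ ^ 2 ≤ (inner ℂ y (hT.resolvent s y)).re := by
  have h_gen : T.generator = - -T.generator := (neg_neg _).symm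
  have h_re := hT.re_inner_nonneg_of_mem_graph h_gen (hT.resolvent_mem_graph h_gen hs y)
  rw [inner_sub_right, Complex.sub_re, ← Complex.coe_smul, inner_smul_right, Complex.re_ofReal_mul,
    ← inner_conj_symm, Complex.conj_re, sub_nonneg] at h_re
  exact (congrArg (s * ·) (inner_self_eq_norm_sq (𝕜 := ℂ) _).symm).trans_le h_re

theorem IsContractive.integrableOn_rpow_mul_re_inner_resolvent {ε : ℝ} (hε : 0 < ε) (y : X) :
    IntegrableOn (fun s : ℝ => s ^ (-(1 / 2) : ℝ) * (inner ℂ y (hT.resolvent s y)).re) (Ioi ε) := by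
  have h_re := (hT.integrableOn_rpow_smul_map_resolvent hε (innerSL ℂ y) y).re
  simpa only [IntegrableOn, RCLike.smul_re, RCLike.re_to_complex, innerSL_apply_apply] using h_re

theorem IsContractive.re_inner_negSqrtTrunc {ε : ℝ} (hε : 0 < ε) (y : X) :
    (inner ℂ y (hT.negSqrtTrunc ε y)).re = Real.pi⁻¹ *
      ∫ s in Ioi ε, s ^ (-(1 / 2) : ℝ) * (inner ℂ y (hT.resolvent s y)).re := by
  have h_int := hT.integrableOn_rpow_smul_map_resolvent hε (innerSL ℂ y) y
  have h_map := congrArg Complex.re (hT.map_negSqrtTrunc hε (innerSL ℂ y) y)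
  rw [Complex.smul_re, smul_eq_mul, ← RCLike.re_to_complex, ← RCLike.re_to_complex,
    ← integral_re h_int] at h_map
  simpa only [RCLike.smul_re, RCLike.re_to_complex, innerSL_apply_apply] using h_map

theorem IsContractive.rpow_mul_re_inner_resolvent_nonneg {s : ℝ} (hs : 0 < s) (y : X) :
    0 ≤ s ^ (-(1 / 2) : ℝ) * (inner ℂ y (hT.resolvent s y)).re :=
  mul_nonneg (Real.rpow_nonneg hs.le _)
    ((by positivity : 0 ≤ s * _).trans (hT.mul_sq_norm_resolvent_le hs y))

theorem IsContractive.antitoneOn_re_inner_negSqrtTrunc (y : X) :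
    AntitoneOn (fun ε => (inner ℂ y (hT.negSqrtTrunc ε y)).re) (Ioi 0) := by
  intro ε hε ε' hε' h_le
  simp only [hT.re_inner_negSqrtTrunc hε, hT.re_inner_negSqrtTrunc hε']
  refine mul_le_mul_of_nonneg_left (setIntegral_mono_set
    (hT.integrableOn_rpow_mul_re_inner_resolvent hε y) ?_ (Ioi_subset_Ioi h_le).eventuallyLE)
    (inv_nonneg.2 Real.pi_pos.le)
  filter_upwards [ae_restrict_mem measurableSet_Ioi] with s hs
  exact hT.rpow_mul_re_inner_resolvent_nonneg ((mem_Ioi.1 hε).trans hs) y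

theorem IsContractive.exists_resolvent_eq_zero {y : X}
    (hy : (inner ℂ y (hT.negSqrtTrunc 1 y)).re ≤ 0) : ∃ s > 0, hT.resolvent s y = 0 := by
  have h_nonneg : ∀ᵐ s ∂volume.restrict (Ioi 1),
      0 ≤ s ^ (-(1 / 2) : ℝ) * (inner ℂ y (hT.resolvent s y)).re := by
    filter_upwards [ae_restrict_mem measurableSet_Ioi] with s hs
    exact hT.rpow_mul_re_inner_resolvent_nonneg (one_pos.trans hs) y
  rw [hT.re_inner_negSqrtTrunc one_pos] at hy
  have h_zero := (nonpos_of_mul_nonpos_right hy (inv_pos.2 Real.pi_pos)).antisymm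
    (integral_nonneg_of_ae h_nonneg)
  rw [setIntegral_eq_zero_iff_of_nonneg_ae h_nonneg
    (hT.integrableOn_rpow_mul_re_inner_resolvent one_pos y)] at h_zero
  have : (ae (volume.restrict (Ioi (1 : ℝ)))).NeBot := ae_restrict_neBot.2 (by simp)
  obtain ⟨s, hs_zero, hs⟩ := (h_zero.and (ae_restrict_mem measurableSet_Ioi)).exists
  have hs_pos : 0 < s := one_pos.trans hs
  have h_re : (inner ℂ y (hT.resolvent s y)).re = 0 :=
    (mul_eq_zero.1 hs_zero).resolve_left (Real.rpow_pos_of_pos hs_pos _).ne'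
  have h_sq := hT.mul_sq_norm_resolvent_le hs_pos y
  rw [h_re] at h_sq
  refine ⟨s, hs_pos, norm_le_zero_iff.1 (sq_nonpos_iff _ |>.1 ?_).le⟩
  exact nonpos_of_mul_nonpos_right h_sq hs_pos

variable (hB : T.generator = -B)

include hB

theorem IsContractive.eq_zero_of_re_inner_negSqrt_nonpos {y z : X} (hz : B.HasNegSqrt y z)
    (h : (inner ℂ y z).re ≤ 0) : y = 0 := by
  have h_lim : Tendsto (fun ε => (inner ℂ y (hT.negSqrtTrunc ε y)).re) (𝓝[>] 0)
      (𝓝 (inner ℂ y z).re) :=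
    (Complex.continuous_re.tendsto _).comp
      (tendsto_const_nhds.inner ((hT.hasNegSqrt_iff hB).1 hz))
  have h_le : (inner ℂ y (hT.negSqrtTrunc 1 y)).re ≤ (inner ℂ y z).re := by
    refine ge_of_tendsto h_lim ?_
    filter_upwards [Ioc_mem_nhdsGT one_pos] with ε hε
    exact hT.antitoneOn_re_inner_negSqrtTrunc y hε.1 (mem_Ioi.2 one_pos) hε.2
  obtain ⟨s, hs, hs_zero⟩ := hT.exists_resolvent_eq_zero (h_le.trans h)
  have h_graph := hT.resolvent_mem_graph hB hs y
  rw [hs_zero, smul_zero, sub_zero] at h_graph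
  exact B.graph_fst_eq_zero_snd h_graph rfl

theorem IsContractive.denseRange_negSqrt {P : X →L[ℂ] X} (hP : ∀ y, B.HasNegSqrt y (P y)) :
    DenseRange P := by
  change Dense (P.range : Set X)
  rw [Submodule.dense_iff_topologicalClosure_eq_top, Submodule.topologicalClosure_eq_top_iff,
    Submodule.eq_bot_iff]
  intro w hw
  refine hT.eq_zero_of_re_inner_negSqrt_nonpos hB (hP w) (le_of_eq ?_)
  rw [(Submodule.mem_orthogonal' _ _).1 hw (P w) ⟨w, rfl⟩, Complex.zero_re]

end DenseRange

section ExactObservability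

section Contractive

variable {X Y : Type*} [NormedAddCommGroup X] [NormedSpace ℂ X] [NormedAddCommGroup Y]
  [NormedSpace ℂ Y] {T : C0Semigroup X} (hT : T.IsContractive) {η : ℝ}

include hT

theorem IsContractive.continuous_integral_sq_norm_map_orbit (G : X →L[ℂ] Y) (η : ℝ) :
    Continuous fun v => ∫ t in (0 : ℝ)..η, ‖G (T.orbit v t)‖ ^ 2 := by
  have h_orbit : Continuous fun p : X × ℝ => T.orbit p.1 p.2 :=
    continuous_prod_of_continuous_lipschitzWith _ 1 (fun v => T.continuous_orbit v) fun t =>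
      (LipschitzWith.of_dist_le_mul fun v w => by
        rw [NNReal.coe_one, one_mul, dist_eq_norm, dist_eq_norm, orbit, orbit, ← map_sub]
        exact hT _ _)
  exact intervalIntegral.continuous_parametric_intervalIntegral_of_continuous'
    ((G.continuous.comp h_orbit).norm.pow 2) 0 η

theorem IsContractive.sq_norm_le_integral_of_denseRange {P Q : X →L[ℂ] X} (hP : DenseRange P)
    (hPT : ∀ t y, T.op t (P y) = P (T.op t y)) (hQT : ∀ t y, T.op t (Q y) = Q (T.op t y))
    (hPQ : ∀ y, P (Q y) = Q (P y)) {K : ℝ} (hK : 0 ≤ K) (hη : 0 ≤ η)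
    (hP_le : ∀ y, ‖P y‖ ^ 2 ≤ K * ∫ t in (0 : ℝ)..η, ‖T.orbit y t‖ ^ 2)
    {G : X →L[ℂ] Y} {δ : ℝ} (hδ : 0 ≤ δ) (hG : ∀ y, δ * ‖Q y‖ ≤ ‖G (P y)‖) (v : X) :
    δ ^ 2 * ‖Q v‖ ^ 2 ≤ K * ∫ t in (0 : ℝ)..η, ‖G (T.orbit v t)‖ ^ 2 := by
  refine hP.induction_on (p := fun v =>
    δ ^ 2 * ‖Q v‖ ^ 2 ≤ K * ∫ t in (0 : ℝ)..η, ‖G (T.orbit v t)‖ ^ 2) v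
    (isClosed_le (by fun_prop) ((hT.continuous_integral_sq_norm_map_orbit G η).const_mul K))
    fun y => ?_
  calc δ ^ 2 * ‖Q (P y)‖ ^ 2
      = δ ^ 2 * ‖P (Q y)‖ ^ 2 := by rw [hPQ]
    _ ≤ δ ^ 2 * (K * ∫ t in (0 : ℝ)..η, ‖T.orbit (Q y) t‖ ^ 2) := by
        gcongr
        exact hP_le (Q y)
    _ = K * ∫ t in (0 : ℝ)..η, (δ * ‖T.orbit (Q y) t‖) ^ 2 := by
        simp only [mul_pow, intervalIntegral.integral_const_mul]
        ring
    _ ≤ K * ∫ t in (0 : ℝ)..η, ‖G (T.orbit (P y) t)‖ ^ 2 := by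
        refine mul_le_mul_of_nonneg_left (intervalIntegral.integral_mono_on hη
          (Continuous.intervalIntegrable (by fun_prop) _ _)
          (Continuous.intervalIntegrable (by fun_prop) _ _) fun t _ => ?_) hK
        rw [orbit, hQT, orbit, hPT]
        gcongr
        exact hG _

theorem IsContractive.exists_continuousLinearMap_resolvent [CompleteSpace X] {B : X →ₗ.[ℂ] X}
    (hB : T.generator = -B) {C : B.domain →ₗ[ℂ] Y} (hC : B.IsBoundedOnDomain C) :
    ∃ G : X →L[ℂ] Y, ∀ v, ∀ x : B.domain, hT.resolvent 1 v = x → G v = C x := by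
  obtain ⟨M, hM⟩ := hC
  have h_graph (v : X) := hT.resolvent_mem_graph hB one_pos v
  set R : X →ₗ[ℂ] B.domain := (hT.resolvent 1).toLinearMap.codRestrict B.domain fun v =>
    B.mem_domain_of_mem_graph (h_graph v)
  refine ⟨(C ∘ₗ R).mkContinuous (|M| * 3) fun v => ?_, fun v x hx =>
    congrArg C (Subtype.ext hx)⟩
  have h_apply : B (R v) = v - (1 : ℝ) • hT.resolvent 1 v :=
    B.mem_graph_snd_inj (B.mem_graph (R v)) (h_graph v) rfl
  have h_res : ‖hT.resolvent 1 v‖ ≤ ‖v‖ := by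
    simpa only [inv_one, one_mul] using hT.norm_resolvent_apply_le one_pos v
  calc ‖C (R v)‖
      ≤ M * (‖hT.resolvent 1 v‖ + ‖B (R v)‖) := hM (R v)
    _ ≤ |M| * (‖v‖ + 2 * ‖v‖) := by
        rw [h_apply]
        gcongr
        · exact le_abs_self M
        · exact hT.norm_sub_smul_resolvent_le one_pos v
    _ = |M| * 3 * ‖v‖ := by ring

end Contractive

theorem IsContractive.exactlyObservableInTime {X Y : Type*} [NormedAddCommGroup X]
    [InnerProductSpace ℂ X] [CompleteSpace X] [NormedAddCommGroup Y] [NormedSpace ℂ Y]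
    {T : C0Semigroup X} (hT : T.IsContractive) {B : X →ₗ.[ℂ] X} (hB : T.generator = -B)
    {C : B.domain →ₗ[ℂ] Y} (hC : B.IsBoundedOnDomain C) {δ : ℝ} (hδ : 0 < δ)
    (hlow : ∀ x : B.domain, ∃ z : B.domain,
      B.HasNegSqrt (x : X) (z : X) ∧ δ * ‖(x : X)‖ ≤ ‖C z‖) {η : ℝ} (hη : 0 < η) :
    T.ExactlyObservableInTime hB C η := by
  obtain ⟨P, hP⟩ := hT.exists_continuousLinearMap_hasNegSqrt hB fun x hx =>
    (hlow ⟨x, hx⟩).imp' _ fun _ hz => hz.1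
  obtain ⟨G, hG⟩ := hT.exists_continuousLinearMap_resolvent hB hC
  obtain ⟨K, hK_pos, hK⟩ := hT.exists_sq_norm_le_integral_of_hasNegSqrt hB hP hη
  have hPT := hT.op_negSqrt_comm hB hP
  have hPR := hT.map_resolvent_of_comm one_pos P fun t y => (hPT t y).symm
  have hGP (y : X) : δ * ‖hT.resolvent 1 y‖ ≤ ‖G (P y)‖ := by
    obtain ⟨z, hz, h_le⟩ := hlow
      ⟨_, B.mem_domain_of_mem_graph (hT.resolvent_mem_graph hB one_pos y)⟩
    rwa [← hG (P y) z ((hPR y).symm.trans (tendsto_nhds_unique (hP _) hz))] at h_le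
  refine ⟨√(δ ^ 2 / K), by positivity, fun x hx => ?_⟩
  have h_obs := hT.sq_norm_le_integral_of_denseRange (hT.denseRange_negSqrt hB hP) hPT
    (hT.op_resolvent one_pos) hPR hK_pos.le hη.le hK hδ.le hGP ((1 : ℝ) • (x : X) + B x)
  have h_res : hT.resolvent 1 ((1 : ℝ) • (x : X) + B x) = x :=
    hT.resolvent_smul_add hB one_pos (B.mem_graph x)
  have h_orbit (t : ℝ) :
      G (T.orbit ((1 : ℝ) • (x : X) + B x) t) = C (T.onDomain hB t.toNNReal x) := by
    refine hG _ _ ?_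
    rw [orbit, ← hT.op_resolvent one_pos, h_res]
    rfl
  rw [h_res, hx, one_pow, mul_one] at h_obs
  rw [Real.sq_sqrt (by positivity), div_le_iff₀' hK_pos]
  simpa only [h_orbit] using h_obs

section Rescale

variable {X Y : Type*} [NormedAddCommGroup X] [NormedSpace ℂ X] [NormedAddCommGroup Y]
  [NormedSpace ℂ Y] {T : C0Semigroup X} {A : X →ₗ.[ℂ] X} (hA : T.generator = -A)
  {C : A.domain →ₗ[ℂ] Y}

theorem continuous_map_onDomain (hC : A.IsBoundedOnDomain C) (x : A.domain) :
    Continuous fun t : ℝ => C (T.onDomain hA t.toNNReal x) := by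
  obtain ⟨M, hM⟩ := hC
  refine continuous_iff_continuousAt.2 fun r => tendsto_sub_nhds_zero_iff.1 <|
    squeeze_zero_norm (a := fun t => M * (‖T.orbit (x : X) t - T.orbit (x : X) r‖ +
      ‖T.orbit (A x) t - T.orbit (A x) r‖)) (fun t => ?_) ?_
  · rw [← map_sub]
    refine (hM _).trans_eq ?_
    rw [LinearPMap.map_sub, apply_onDomain, apply_onDomain]
    rfl
  · have h_cont : Continuous fun t => M * (‖T.orbit (x : X) t - T.orbit (x : X) r‖ +
        ‖T.orbit (A x) t - T.orbit (A x) r‖) := by fun_prop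
    simpa only [sub_self, norm_zero, add_zero, mul_zero] using h_cont.tendsto r

theorem isBoundedOnDomain_addScalar (hC : A.IsBoundedOnDomain C) (ω : ℝ) :
    (A.addScalar ω).IsBoundedOnDomain C := by
  obtain ⟨M, hM⟩ := hC
  refine ⟨|M| * (1 + |ω|), fun x => ?_⟩
  have h_apply : A x = A.addScalar ω x - ω • (x : X) :=
    (add_sub_cancel_left (ω • (x : X)) (A x)).symm
  have h_norm : ‖A x‖ ≤ ‖A.addScalar ω x‖ + |ω| * ‖(x : X)‖ := by
    rw [h_apply, ← Real.norm_eq_abs, ← norm_smul]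
    exact norm_sub_le _ _
  calc ‖C x‖
      ≤ M * (‖(x : X)‖ + ‖A x‖) := hM x
    _ ≤ |M| * (‖(x : X)‖ + (‖A.addScalar ω x‖ + |ω| * ‖(x : X)‖)) := by
        gcongr
        exact le_abs_self M
    _ ≤ |M| * (1 + |ω|) * (‖(x : X)‖ + ‖A.addScalar ω x‖) := by
        rw [mul_assoc]
        gcongr
        nlinarith [mul_nonneg (abs_nonneg ω) (norm_nonneg (A.addScalar ω x))]

theorem norm_map_onDomain_rescale_le {ω η t : ℝ} (ht : t ∈ Icc 0 η) (x : A.domain) :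
    ‖C ((T.rescale ω).onDomain (A := A.addScalar ω) (generator_rescale ω hA) t.toNNReal x)‖ ≤
      Real.exp (|ω| * η) * ‖C (T.onDomain hA t.toNNReal x)‖ := by
  have h_rescale :
      (T.rescale ω).onDomain (A := A.addScalar ω) (generator_rescale ω hA) t.toNNReal x =
        (Real.exp (-ω * t) : ℂ) • T.onDomain hA t.toNNReal x :=
    Subtype.ext (T.orbit_rescale ω (x : X) ht.1)
  have h_exp : -ω * t ≤ |ω| * η :=
    mul_le_mul (neg_le_abs ω) ht.2 ht.1 (abs_nonneg ω)
  rw [h_rescale, map_smul, norm_smul, Complex.norm_real, Real.norm_of_nonneg (Real.exp_nonneg _)]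
  gcongr

theorem exactlyObservableInTime_of_rescale (hC : A.IsBoundedOnDomain C) {ω η : ℝ} (hη : 0 ≤ η)
    (h : (T.rescale ω).ExactlyObservableInTime (A := A.addScalar ω) (generator_rescale ω hA)
      C η) :
    T.ExactlyObservableInTime hA C η := by
  obtain ⟨m, hm_pos, hm⟩ := h
  refine ⟨m / Real.exp (|ω| * η), by positivity, fun x hx => ?_⟩
  have h_cont := continuous_map_onDomain hA hC x
  have h_cont_rescale := continuous_map_onDomain (A := A.addScalar ω) (generator_rescale ω hA)
    (isBoundedOnDomain_addScalar hC ω) x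
  rw [div_pow, div_le_iff₀' (by positivity)]
  calc m ^ 2
      ≤ ∫ t in (0 : ℝ)..η, ‖C ((T.rescale ω).onDomain (A := A.addScalar ω)
          (generator_rescale ω hA) t.toNNReal x)‖ ^ 2 := hm x hx
    _ ≤ ∫ t in (0 : ℝ)..η, (Real.exp (|ω| * η) * ‖C (T.onDomain hA t.toNNReal x)‖) ^ 2 := by
        refine intervalIntegral.integral_mono_on hη
          ((h_cont_rescale.norm.pow 2).intervalIntegrable _ _)
          (((h_cont.norm.const_mul _).pow 2).intervalIntegrable _ _) fun t ht => ?_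
        exact pow_le_pow_left₀ (norm_nonneg _) (norm_map_onDomain_rescale_le hA ht x) 2
    _ = Real.exp (|ω| * η) ^ 2 *
          ∫ t in (0 : ℝ)..η, ‖C (T.onDomain hA t.toNNReal x)‖ ^ 2 := by
        simp only [mul_pow, intervalIntegral.integral_const_mul]

end Rescale

end ExactObservability

end C0Semigroup

theorem mainTheorem12_general
    {X : Type*} [NormedAddCommGroup X] [InnerProductSpace ℂ X] [CompleteSpace X]
    {Y : Type*} [NormedAddCommGroup Y] [NormedSpace ℂ Y]
    (T : C0Semigroup X) (A : X →ₗ.[ℂ] X) (hA : T.generator = -A)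
    (ω : ℝ) (hacc : (A.addScalar ω).IsAccretive)
    (C : A.domain →ₗ[ℂ] Y) (hC : A.IsBoundedOnDomain C)
    (δ : ℝ) (hδ : 0 < δ)
    (hlow : ∀ x : A.domain, ∃ z : A.domain,
      (A.addScalar ω).HasNegSqrt (x : X) (z : X) ∧ δ * ‖(x : X)‖ ≤ ‖C z‖)
    (η : ℝ) (hη : 0 < η) :
    T.ExactlyObservableInTime hA C η := by
  have hB : (T.rescale ω).generator = -(A.addScalar ω) := C0Semigroup.generator_rescale ω hA
  have hT : (T.rescale ω).IsContractive := C0Semigroup.isContractive_of_isAccretive hB hacc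
  have hC' : (A.addScalar ω).IsBoundedOnDomain C := C0Semigroup.isBoundedOnDomain_addScalar hC ω
  exact C0Semigroup.exactlyObservableInTime_of_rescale hA hC hη.le
    (hT.exactlyObservableInTime hB hC' hδ hlow hη)

theorem mainTheorem12
    {X : Type*} [NormedAddCommGroup X] [InnerProductSpace ℂ X] [CompleteSpace X]
    {Y : Type*} [NormedAddCommGroup Y] [NormedSpace ℂ Y] [CompleteSpace Y]
    (T : C0Semigroup X) (A : X →ₗ.[ℂ] X) (hA : T.generator = -A)
    (ω : ℝ) (hω : 0 < ω) (hacc : (A.addScalar ω).IsAccretive)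
    (C : A.domain →ₗ[ℂ] Y) (hC : A.IsBoundedOnDomain C)
    (δ : ℝ) (hδ : 0 < δ)
    (hlow : ∀ x : A.domain, ∃ z : A.domain,
      (A.addScalar ω).HasNegSqrt (x : X) (z : X) ∧ δ * ‖(x : X)‖ ≤ ‖C z‖) :
    ∃ η : ℝ, 0 < η ∧ T.ExactlyObservableInTime hA C η := by
  exact ⟨1, one_pos, mainTheorem12_general T A hA ω hacc C hC δ hδ hlow 1 one_pos⟩
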